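/- Let $S$ be a unital topological semigroup (a topological monoid, with jointly continuous multiplication) with a continuous involution $s\mapsto s^*$, that is, $s^{**}=s$ and $(st)^*=t^*s^*$. Let $\Omega(S)$ be the class of all pairs $(\omega,M)$ where $M$ is a $W^*$-algebra with predual $M_*$ and $\omega$ is a $*$-homomorphism of $S$ into the closed unit ball of $M$ (so $\omega(st)=\omega(s)\omega(t)$, $\omega(s^*)=\omega(s)^*$) that is continuous for $\sigma=\sigma(M,M_*)$ and such that the linear span of $\omega(S)$ is $\sigma$-dense in $M$. For $\psi\in M_*$ put $\hat\psi=\psi\circ\omega$. Let $F(S)$ be the set of all functions $\hat\psi$ on $S$ with $(\omega,M)\in\Omega(S)$, $\psi\in M_*$, and let $\|f\|_\Omega=\inf\{\|\psi\| : (\omega,M)\in\Omega(S),\ \psi\in M_*,\ \hat\psi=f\}$. A pair $(\omega_\Omega,W^*_\Omega(S))\in\Omega(S)$ is called universal if for every $(\omega,M)\in\Omega(S)$ there is a $\sigma$-$\sigma$-continuous $*$-homomorphism $\theta:W^*_\Omega(S)\to M$ with $\theta\circ\omega_\Omega=\omega$. An $F$-algebra in Lau's sense is a complex Banach algebra that is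 (isometrically) the predual of a $W^*$-algebra whose identity is a (nonzero) multiplicative linear functional on it. Proposition 3.3. With the pointwise operations and $\|\cdot\|_\Omega$, $F(S)$ is a commutative Banach algebra of functions on $S$ containing the constants, and it is an $F$-algebra in Lau's sense. More precisely, a universal pair $(\omega_\Omega,W^*_\Omega(S))$ exists, and for every such pair $\psi\mapsto\hat\psi=\psi\circ\omega_\Omega$ is an isometric linear isomorphism of the predual $W^*_\Omega(S)_*$ onto $(F(S),\|\cdot\|_\Omega)$; under the resulting duality $\langle x,\hat\psi\rangle=\psi(x)$ the $W^*$-algebra $W^*_\Omega(S)$ is the dual Banach space of $F(S)$, and its identity is a nonzero multiplicative linear functional on $F(S)$. -/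

import Mathlib

universe u

namespace FourierStieltjes

/-- A C⋆-algebra `M` together with an identification `e` of `M` with the dual of a Banach space `X`
(so `M` is a W⋆-algebra in the sense of Sakai and `X = M_*` its predual, see `wStarAlgebra_iff`).
The pairing of `x : M` and `ψ : X` is `ψ(x) = e x ψ`, and this is the weak topology `σ(M, M_*)`,
the coarsest one for which all `x ↦ ψ(x)` are continuous. -/
@[reducible] noncomputable def sigma {M X : Type u} [CStarAlgebra M] [NormedAddCommGroup X] [NormedSpace ℂ X]
    (e : M ≃ₗᵢ[ℂ] StrongDual ℂ X) : TopologicalSpace M :=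
  TopologicalSpace.induced (fun (x : M) (ψ : X) => e x ψ) Pi.topologicalSpace

/-- Sakai's W⋆-algebras are exactly the C⋆-algebras that are isometrically the dual of a Banach
space. -/
theorem wStarAlgebra_iff {M : Type u} [CStarAlgebra M] :
    WStarAlgebra M ↔ ∃ (X : Type u) (_ : NormedAddCommGroup X) (_ : NormedSpace ℂ X)
      (_ : CompleteSpace X), Nonempty (M ≃ₗᵢ[ℂ] StrongDual ℂ X) := by
  constructor
  · rintro ⟨X, i₁, i₂, i₃, ⟨e⟩⟩
    exact ⟨X, i₁, i₂, i₃, ⟨(starₗᵢ ℂ : M ≃ₗᵢ⋆[ℂ] M).trans e.symm⟩⟩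
  · rintro ⟨X, i₁, i₂, i₃, ⟨e⟩⟩
    exact ⟨X, i₁, i₂, i₃, ⟨e.symm.trans (starₗᵢ ℂ : M ≃ₗᵢ⋆[ℂ] M)⟩⟩

/-- The class `Ω(S)` of `σ`-continuous `*`-representations of a topological semigroup `S` with
involution: a W⋆-algebra `M` with its predual `X = M_*`, and a `*`-homomorphism `ω` of `S` into
the unit ball of `M`, continuous for `σ(M, M_*)`, such that the linear span of `ω(S)` is
`σ(M, M_*)`-dense in `M`. -/
structure SigmaRep (S : Type u) [Semigroup S] [StarMul S] [TopologicalSpace S] where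
  M : Type u
  X : Type u
  [cstarAlgebra : CStarAlgebra M]
  [normedAddCommGroup : NormedAddCommGroup X]
  [normedSpace : NormedSpace ℂ X]
  [completeSpace : CompleteSpace X]
  dualEquiv : M ≃ₗᵢ[ℂ] StrongDual ℂ X
  ω : S → M
  map_mul : ∀ s t, ω (s * t) = ω s * ω t
  map_star : ∀ s, ω (star s) = star (ω s)
  norm_le_one : ∀ s, ‖ω s‖ ≤ 1
  continuous_sigma : @Continuous S M _ (sigma dualEquiv) ω
  dense_span : @Dense M (sigma dualEquiv) (Submodule.span ℂ (Set.range ω) : Set M)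

attribute [instance] SigmaRep.cstarAlgebra SigmaRep.normedAddCommGroup SigmaRep.normedSpace
  SigmaRep.completeSpace

section

variable {S : Type u} [Semigroup S] [StarMul S] [TopologicalSpace S]

/-- The function `ψ̂ = ψ ∘ ω` on `S`, for `(ω, M) ∈ Ω(S)` and `ψ ∈ M_*`. -/
noncomputable def SigmaRep.hat (α : SigmaRep S) (ψ : α.X) : S → ℂ := fun s => α.dualEquiv (α.ω s) ψ

variable (S) in
/-- `F(S)`: all functions `ψ̂` with `(ω, M) ∈ Ω(S)` and `ψ ∈ M_*`. -/
def F : Set (S → ℂ) := {f | ∃ (α : SigmaRep S) (ψ : α.X), α.hat ψ = f}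

/-- `‖f‖_Ω`: the infimum of `‖ψ‖` over all ways to write `f = ψ̂` with `(ω, M) ∈ Ω(S)` and
`ψ ∈ M_*`. -/
noncomputable def normΩ (f : S → ℂ) : ℝ :=
  sInf {r : ℝ | ∃ (α : SigmaRep S) (ψ : α.X), α.hat ψ = f ∧ ‖ψ‖ = r}

/-- `U = (ω_Ω, W*_Ω(S))` is a universal representation: every `(ω, M) ∈ Ω(S)` is `θ ∘ ω_Ω`
for a `σ`-`σ`-continuous `*`-homomorphism `θ : W*_Ω(S) → M` (which is unique, because the span of
`ω_Ω(S)` is `σ`-dense). -/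
def SigmaRep.IsUniversal (U : SigmaRep S) : Prop :=
  ∀ α : SigmaRep S, ∃ θ : U.M →⋆ₐ[ℂ] α.M,
    @Continuous U.M α.M (sigma U.dualEquiv) (sigma α.dualEquiv) θ ∧ ∀ s, θ (U.ω s) = α.ω s

/-- The Banach algebra `A`, through the injective algebra homomorphism `ι` into the functions on
`S` with pointwise operations, is `F(S)` with the norm `‖·‖_Ω`. -/
structure IsFourierStieltjesAlgebra (A : Type u) [NormedCommRing A] [NormedAlgebra ℂ A]
    (ι : A →ₐ[ℂ] (S → ℂ)) : Prop where
  complete : CompleteSpace A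
  injective : Function.Injective ι
  range_eq : Set.range ι = F S
  norm_eq : ∀ a, ‖a‖ = normΩ (ι a)

end

/-- The Banach algebra `A` is the predual of the C⋆-algebra `M` through `e` (so that `M` is a
W⋆-algebra), and the identity of `M` is a multiplicative linear functional on `A`; such functionals
are nonzero by convention. -/
structure IsFAlgebraVia {A : Type u} [NonUnitalNormedRing A] [NormedSpace ℂ A]
    [IsScalarTower ℂ A A] [SMulCommClass ℂ A A] {M : Type u} [CStarAlgebra M]
    (e : M ≃ₗᵢ[ℂ] StrongDual ℂ A) : Prop where
  complete : CompleteSpace A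
  one_mul : ∀ a b : A, e 1 (a * b) = e 1 a * e 1 b
  one_ne_zero : e 1 ≠ 0

/-- `F`-algebras in the sense of Lau. -/
def IsFAlgebra (A : Type u) [NonUnitalNormedRing A] [NormedSpace ℂ A]
    [IsScalarTower ℂ A A] [SMulCommClass ℂ A A] : Prop :=
  ∃ (M : Type u) (_ : CStarAlgebra M) (e : M ≃ₗᵢ[ℂ] StrongDual ℂ A), IsFAlgebraVia e

end FourierStieltjes

/-! Everything rests on one element of `Ω(S)` whose predual carries all of `F(S)` with the right
norms. Call `U` dominating if every `ψ̂` equals `φ̂` for some `φ` in the predual of `U` with `‖φ‖ ≤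
‖ψ‖`. Since the span of `ω(S)` is `σ`-dense, `φ ↦ φ̂` is injective; for dominating `U` it is then an
isometry of the predual onto `F(S)`. Dominating is the same as universal: pulling functionals back
along `θ` gives one direction, and the adjoint of the contraction `ψ ↦ φ` is the required `θ` in the
other.

A dominating `U` and the algebra structure both come from an intrinsic description of `F(S)`. If `f
= ψ̂` and `r = ‖ψ‖`, translating `ψ` by an element where it attains its norm gives a positive
functional. Its coefficient `p` is continuous and positive definite, has `p 1 = r` and a contractive
GNS representation, and `r p(s* t) - conj (f s) f t` is a positive semidefinite kernel
(`SigmaRep.exists_isCoefficient_hat`). Conversely, from such `p` the GNS construction recovers `f`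
as a vector coefficient of norm at most `r`, and the direct sum over all `(f, r)` is dominating
(`exists_sigmaRep_all_coefficients`). By Schur's product theorem the description is stable under
products (`IsCoefficient.mul`), whence `‖f g‖ ≤ ‖f‖ ‖g‖`. The identity of the W⋆-algebra acts on
`F(S)` as evaluation at `1`, so it is multiplicative.

The predual is given only abstractly, so the `σ`-continuity of the involution and of one-sided
multiplications must be derived from duality. By `exists_predual_of_tendsto_zero` and Banach–Alaoglu
it suffices that a `σ`-limit of `b * x i` vanishes when the bounded family `x i` tends to `0`. This
follows from a locality principle for such limits (`cfc_mul_eq_zero_of_sigmaTendsto`) and a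
partition of unity on the spectrum of `b`. -/

namespace FourierStieltjes

open Filter Topology

/-! ### Weak limits in dual Banach spaces and recognition of predual functionals -/

section DualBanach

variable {M X : Type u} [NormedAddCommGroup M] [NormedSpace ℂ M] [NormedAddCommGroup X]
  [NormedSpace ℂ X] {e : M ≃ₗᵢ[ℂ] StrongDual ℂ X} {ι : Type*}

/-- Convergence of `x` to `y` along `l` for the weak topology `σ(M, X)`. -/
def SigmaTendsto (e : M ≃ₗᵢ[ℂ] StrongDual ℂ X) (l : Filter ι) (x : ι → M) (y : M) : Prop :=
  ∀ ψ : X, Tendsto (fun i => e (x i) ψ) l (𝓝 (e y ψ))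

/-- Bounded subsets of a dual Banach space are relatively compact (Banach–Alaoglu). -/
theorem exists_sigmaTendsto (U : Ultrafilter ι) {x : ι → M} {R : ℝ}
    (hx : ∀ᶠ i in U, ‖x i‖ ≤ R) : ∃ y, SigmaTendsto e U x y := by
  have hK := WeakDual.isCompact_closedBall (𝕜 := ℂ) (0 : StrongDual ℂ X) R
  obtain ⟨z, -, hz⟩ := hK.ultrafilter_le_nhds
    (U.map fun i => StrongDual.toWeakDual (e (x i))) (by
      rw [le_principal_iff, Ultrafilter.coe_map, mem_map]
      filter_upwards [hx] with i hi
      simpa using hi)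
  refine ⟨e.symm (WeakDual.toStrongDual z), fun ψ => ?_⟩
  have h := ((WeakDual.eval_continuous ψ).tendsto z).comp (tendsto_map'_iff.1 hz)
  rw [LinearIsometryEquiv.apply_symm_apply]
  exact h

namespace SigmaTendsto

variable {l : Filter ι} {x x' : ι → M} {y y' : M}

theorem add (h : SigmaTendsto e l x y) (h' : SigmaTendsto e l x' y') :
    SigmaTendsto e l (fun i => x i + x' i) (y + y') := fun ψ => by
  simpa using (h ψ).add (h' ψ)

theorem sub (h : SigmaTendsto e l x y) (h' : SigmaTendsto e l x' y') :
    SigmaTendsto e l (fun i => x i - x' i) (y - y') := fun ψ => by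
  simpa using (h ψ).sub (h' ψ)

theorem smul (c : ℂ) (h : SigmaTendsto e l x y) :
    SigmaTendsto e l (fun i => c • x i) (c • y) := fun ψ => by
  simpa using (h ψ).const_mul c

theorem const (y : M) : SigmaTendsto e l (fun _ => y) y := fun _ => tendsto_const_nhds

theorem unique [l.NeBot] (h : SigmaTendsto e l x y) (h' : SigmaTendsto e l x y') : y = y' :=
  e.injective <| ContinuousLinearMap.ext fun ψ => tendsto_nhds_unique (h ψ) (h' ψ)

theorem norm_le [l.NeBot] (h : SigmaTendsto e l x y) {R : ℝ} (hx : ∀ᶠ i in l, ‖x i‖ ≤ R) :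
    ‖y‖ ≤ R := by
  obtain ⟨i, hi⟩ := hx.exists
  rw [← e.norm_map]
  refine ContinuousLinearMap.opNorm_le_bound _ ((norm_nonneg _).trans hi) fun ψ => ?_
  refine le_of_tendsto (h ψ).norm (hx.mono fun i hi => ?_)
  refine (ContinuousLinearMap.le_opNorm _ _).trans ?_
  rw [e.norm_map]
  gcongr

end SigmaTendsto

/-- The predual, embedded isometrically into the dual of `M`. -/
noncomputable def predualEmbedding (e : M ≃ₗᵢ[ℂ] StrongDual ℂ X) : X →ₗᵢ[ℂ] StrongDual ℂ M where
  toFun ψ := (NormedSpace.inclusionInDoubleDual ℂ X ψ).comp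
    (e.toContinuousLinearEquiv : M →L[ℂ] StrongDual ℂ X)
  map_add' ψ φ := by ext; simp
  map_smul' c ψ := by ext; simp
  norm_map' ψ := by
    refine le_antisymm (ContinuousLinearMap.opNorm_le_bound _ (norm_nonneg ψ) fun x => ?_) ?_
    · rw [← e.norm_map x, mul_comm]
      exact (e x).le_opNorm ψ
    · obtain ⟨g, hg, hgψ⟩ := exists_dual_vector'' ℂ ψ
      have h := ContinuousLinearMap.le_opNorm ((NormedSpace.inclusionInDoubleDual ℂ X ψ).comp
        (e.toContinuousLinearEquiv : M →L[ℂ] StrongDual ℂ X)) (e.symm g)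
      have h1 : ‖e.symm g‖ ≤ 1 := by rwa [e.symm.norm_map]
      have h2 : ‖g ψ‖ = ‖ψ‖ := by rw [hgψ]; simp
      simp only [ContinuousLinearMap.comp_apply, ContinuousLinearEquiv.coe_coe,
        LinearIsometryEquiv.coe_toContinuousLinearEquiv, LinearIsometryEquiv.apply_symm_apply,
        NormedSpace.dual_def, h2] at h
      exact h.trans (mul_le_of_le_one_right (norm_nonneg _) h1)

@[simp]
theorem predualEmbedding_apply (ψ : X) (x : M) : predualEmbedding e ψ x = e x ψ := rfl

/-- A functional that is small on the part of the unit ball where finitely many elements of the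
predual are small is close to the predual. -/
theorem exists_norm_sub_predualEmbedding_le (g : StrongDual ℂ M) {ε : ℝ} (hε : 0 ≤ ε)
    (I : Set X) (hI : I.Finite) (h : ∀ x, ‖x‖ ≤ 1 → (∀ ψ ∈ I, e x ψ = 0) → ‖g x‖ ≤ ε) :
    ∃ ψ, ‖g - predualEmbedding e ψ‖ ≤ ε := by
  have := hI.to_subtype
  let L : I → M →ₗ[ℂ] ℂ := fun ψ => (predualEmbedding e ψ.1 : M →ₗ[ℂ] ℂ)
  let W : Submodule ℂ M := ⨅ i, (L i).ker
  -- Hahn–Banach: replace `g` on the joint kernel `W` by a norm-preserving extension `g'`. Then `g -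
  -- g'` kills `W`, hence is a combination of the finitely many given functionals.
  obtain ⟨g', hg', hn⟩ := exists_extension_norm_eq W (g.comp W.subtypeL)
  have hW : ‖g.comp W.subtypeL‖ ≤ ε := by
    refine ContinuousLinearMap.opNorm_le_of_unit_norm hε fun x hx => ?_
    refine h x (by simpa using hx.le) fun ψ hψ => ?_
    simpa [L] using (Submodule.mem_iInf _).1 x.2 ⟨ψ, hψ⟩
  have hspan : ((g - g' : StrongDual ℂ M) : M →ₗ[ℂ] ℂ) ∈ Submodule.span ℂ (Set.range L) := by
    refine mem_span_of_iInf_ker_le_ker fun x hx => ?_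
    simpa [sub_eq_zero] using (hg' ⟨x, hx⟩).symm
  have hrange : Submodule.span ℂ (Set.range L) ≤ LinearMap.range
      ((ContinuousLinearMap.coeLM ℂ : (M →L[ℂ] ℂ) →ₗ[ℂ] (M →ₗ[ℂ] ℂ)) ∘ₗ
        (predualEmbedding e).toLinearMap) := by
    rw [Submodule.span_le]
    rintro _ ⟨ψ, rfl⟩
    exact ⟨ψ.1, rfl⟩
  obtain ⟨ψ, hψ⟩ := hrange hspan
  refine ⟨ψ, ?_⟩
  have : g - predualEmbedding e ψ = g' := by
    ext x
    have := LinearMap.congr_fun hψ x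
    simp at this
    simp [this]
  rw [this, hn]
  exact hW

/-- A functional that is `σ`-continuous at `0` on the unit ball belongs to the predual. -/
theorem exists_predual_of_tendsto_zero [CompleteSpace X] (g : StrongDual ℂ M)
    (h : ∀ U : Ultrafilter M, (∀ᶠ x in (U : Filter M), ‖x‖ ≤ 1) → SigmaTendsto e U id 0 →
      Tendsto g U (𝓝 0)) : ∃ ψ : X, ∀ x, g x = e x ψ := by
  have key : ∀ ε > 0, ∃ ψ, ‖g - predualEmbedding e ψ‖ ≤ ε := by
    intro ε hε
    let N : Filter M := comap (fun x ψ => e x ψ) (𝓝 (0 : X → ℂ))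
    -- `N` is the `σ`-neighbourhood filter of `0`. An ultrafilter on the part of the unit ball where
    -- `‖g‖ ≥ ε` that refines `N` would contradict `h`.
    have hN : (N ⊓ 𝓟 {x | ‖x‖ ≤ 1}) ⊓ 𝓟 {x | ε ≤ ‖g x‖} = ⊥ := by
      by_contra hne
      have : NeBot ((N ⊓ 𝓟 {x | ‖x‖ ≤ 1}) ⊓ 𝓟 {x | ε ≤ ‖g x‖}) := ⟨hne⟩
      have hU := Ultrafilter.of_le ((N ⊓ 𝓟 {x | ‖x‖ ≤ 1}) ⊓ 𝓟 {x | ε ≤ ‖g x‖})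
      set U := Ultrafilter.of ((N ⊓ 𝓟 {x | ‖x‖ ≤ 1}) ⊓ 𝓟 {x | ε ≤ ‖g x‖})
      have h1 : Tendsto g U (𝓝 0) := by
        refine h U (le_principal_iff.1 (hU.trans (inf_le_left.trans inf_le_right))) fun ψ => ?_
        have : Tendsto (fun x ψ => e x ψ) N (𝓝 (0 : X → ℂ)) := tendsto_comap
        simpa using (tendsto_pi_nhds.1 this ψ).mono_left
          (hU.trans (inf_le_left.trans inf_le_left))
      have h2 : ∀ᶠ x in (U : Filter M), ε ≤ ‖g x‖ := le_principal_iff.1 (hU.trans inf_le_right)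
      have h3 := ge_of_tendsto h1.norm h2
      simp at h3
      linarith
    rw [inf_principal_eq_bot, mem_inf_principal] at hN
    obtain ⟨t, ht, hsub⟩ := mem_comap.1 hN
    rw [nhds_pi, mem_pi] at ht
    obtain ⟨I, hI, s, hs, hIs⟩ := ht
    refine exists_norm_sub_predualEmbedding_le g hε.le I hI fun x hx hx0 => ?_
    have : x ∈ (fun x ψ => e x ψ) ⁻¹' t := hIs fun ψ hψ => by
      simpa [hx0 ψ hψ] using mem_of_mem_nhds (hs ψ)
    exact le_of_not_ge (show ¬ ε ≤ ‖g x‖ from hsub this hx)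
  -- Completeness of `X` enters here: its isometric image is closed, so approximation by predual
  -- elements is membership.
  have hcl : IsClosed (Set.range (predualEmbedding e)) :=
    (predualEmbedding e).isometry.isClosedEmbedding.isClosed_range
  have : g ∈ closure (Set.range (predualEmbedding e)) := by
    refine Metric.mem_closure_iff.2 fun ε hε => ?_
    obtain ⟨ψ, hψ⟩ := key (ε / 2) (half_pos hε)
    exact ⟨_, ⟨ψ, rfl⟩, by rw [dist_eq_norm]; linarith⟩
  rw [hcl.closure_eq] at this
  obtain ⟨ψ, rfl⟩ := this
  exact ⟨ψ, fun x => rfl⟩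

end DualBanach

end FourierStieltjes

/-! ### Cauchy–Schwarz for rows and locality of weak limits -/

namespace FourierStieltjes

open Filter Topology

/-- The Cauchy–Schwarz inequality for the Hilbert C⋆-module `A × A`. -/
theorem norm_mul_add_mul_sq_le {A : Type*} [CStarAlgebra A] (b c x w : A) :
    ‖b * x + c * w‖ ^ 2 ≤ ‖b * star b + c * star c‖ * (‖x‖ ^ 2 + ‖w‖ ^ 2) := by
  let _ := CStarAlgebra.spectralOrder A
  have := CStarAlgebra.spectralOrderedRing A
  let E := WithCStarModule A (A × A)
  let p : E := (WithCStarModule.equiv A (A × A)).symm (b, c)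
  let q : E := (WithCStarModule.equiv A (A × A)).symm (star x, star w)
  have h := CStarModule.norm_inner_le (A := A) E (x := q) (y := p)
  have h1 : inner A q p = b * x + c * w := by
    simp [p, q, E, WithCStarModule.prod_inner, WithCStarModule.inner_def]
  have hp : ‖p‖ ^ 2 = ‖b * star b + c * star c‖ := by
    rw [WithCStarModule.prod_norm_sq]; simp [p, WithCStarModule.inner_def]
  have hq : ‖q‖ ^ 2 ≤ ‖x‖ ^ 2 + ‖w‖ ^ 2 := by
    rw [WithCStarModule.prod_norm_sq]
    refine (norm_add_le _ _).trans_eq ?_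
    simp [q, WithCStarModule.inner_def, CStarRing.norm_star_mul_self, sq]
  rw [← h1, ← hp]
  calc ‖inner A q p‖ ^ 2 ≤ (‖q‖ * ‖p‖) ^ 2 := by gcongr
    _ = ‖p‖ ^ 2 * ‖q‖ ^ 2 := by ring
    _ ≤ _ := by gcongr

section

variable {M X : Type u} [CStarAlgebra M] [NormedAddCommGroup X]
  [NormedSpace ℂ X] {e : M ≃ₗᵢ[ℂ] StrongDual ℂ X} {ι : Type*}

/-- The row `(b, c)` is a contraction, so the bound holds for each `b * x i + c * w`; norm bounds
survive `σ`-limits. Only addition of a constant is passed to the limit, so no continuity of the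
product is presupposed. -/
theorem SigmaTendsto.norm_add_mul_sq_le {l : Filter ι} [l.NeBot] {x : ι → M} {R : ℝ}
    (hx : ∀ᶠ i in l, ‖x i‖ ≤ R) {b y : M} (hy : SigmaTendsto e l (fun i => b * x i) y) (c w : M)
    (hbc : ‖b * star b + c * star c‖ ≤ 1) : ‖y + c * w‖ ^ 2 ≤ R ^ 2 + ‖w‖ ^ 2 := by
  have hR : 0 ≤ R ^ 2 + ‖w‖ ^ 2 := by positivity
  refine (Real.le_sqrt (norm_nonneg _) hR).1 <|
    (hy.add (SigmaTendsto.const (c * w))).norm_le (hx.mono fun i hi => ?_)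
  refine Real.le_sqrt_of_sq_le ((norm_mul_add_mul_sq_le _ _ _ _).trans ?_)
  refine (mul_le_of_le_one_left (by positivity) hbc).trans ?_
  gcongr

theorem norm_cfc_mul_self_add_le_one {b : M} {f k : ℝ → ℝ}
    (hf : Continuous f) (hk : Continuous k) (hk1 : ∀ t, |k t| ≤ 1) (hfk : ∀ t, f t * k t = 0)
    (hf1 : ∀ t ∈ spectrum ℝ b, |f t| ≤ 1) :
    ‖cfc f b * star (cfc f b) + cfc k b * star (cfc k b)‖ ≤ 1 := by
  rw [(cfc_predicate f b : IsSelfAdjoint _).star_eq, (cfc_predicate k b : IsSelfAdjoint _).star_eq,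
    ← cfc_mul .., ← cfc_mul .., ← cfc_add ..]
  refine norm_cfc_le zero_le_one fun t ht => ?_
  have h1 := abs_le.1 (hf1 t ht)
  have h2 := abs_le.1 (hk1 t)
  rw [Real.norm_eq_abs, abs_of_nonneg (by nlinarith [sq_nonneg (f t), sq_nonneg (k t)])]
  rcases mul_eq_zero.1 (hfk t) with h | h <;> rw [h] <;> nlinarith

/-- Limits of left multiples of a bounded family by functions of a self-adjoint element are local:
a function of disjoint support annihilates them. -/
theorem cfc_mul_eq_zero_of_sigmaTendsto {l : Filter ι} [l.NeBot] {x : ι → M} {R : ℝ}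
    (hx : ∀ᶠ i in l, ‖x i‖ ≤ R) {b : M} (hb : IsSelfAdjoint b) {f h : ℝ → ℝ}
    (hf : Continuous f) (hh : Continuous h) (h0 : ∀ t, 0 ≤ h t) (h1 : ∀ t, h t ≤ 1)
    (hfh : ∀ t, f t * h t = 0) (hf1 : ∀ t ∈ spectrum ℝ b, |f t| ≤ 1) {y : M}
    (hy : SigmaTendsto e l (fun i => cfc f b * x i) y) : cfc h b * y = 0 := by
  -- The `k n` increase to the indicator of `{h > 0}` and stay disjoint from `f`; `k 1 = h`.
  let k : ℕ → ℝ → ℝ := fun n t => min 1 (n * h t)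
  have hk : ∀ n, Continuous (k n) := fun n => by fun_prop
  have hk0 : ∀ n t, 0 ≤ k n t := fun n t => le_min zero_le_one (mul_nonneg n.cast_nonneg (h0 t))
  have hk1 : ∀ n t, k n t ≤ 1 := fun n t => min_le_left _ _
  have hfk : ∀ n t, f t * k n t = 0 := fun n t => by
    rcases mul_eq_zero.1 (hfh t) with h | h <;> simp [k, h]
  have hnorm : ∀ n, ‖cfc (k n) b‖ ≤ 1 := fun n => norm_cfc_le zero_le_one fun t _ => by
    rw [Real.norm_eq_abs, abs_of_nonneg (hk0 n t)]; exact hk1 n t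
  have step : ∀ B, (∀ m, ‖cfc (k m) b * y‖ ^ 2 ≤ B) → ∀ m (r : ℝ), 0 ≤ r →
      (1 + r) ^ 2 * ‖cfc (k m) b * y‖ ^ 2 ≤ R ^ 2 + r ^ 2 * B := by
    intro B hB m r hr
    have hB0 : 0 ≤ B := (sq_nonneg _).trans (hB 0)
    have main : ∀ n : ℕ, (1 + r) * ‖cfc (k m) b * y‖ ≤
        √(R ^ 2 + r ^ 2 * B) + r * (m * (1 / ((n : ℝ) + 1))) * ‖y‖ := by
      intro n
      -- Feed `r k(n+1) y` back into the row inequality. The error carries `k m (1 - k(n+1)²)`,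
      -- which vanishes where `h ≥ 1/(n+1)` and is at most `m h ≤ m/(n+1)` elsewhere.
      have e1 : ((1 + r : ℝ) : ℂ) • (cfc (k m) b * y) =
          cfc (k m) b * (y + cfc (k (n + 1)) b * ((r : ℂ) • (cfc (k (n + 1)) b * y))) +
          (r : ℂ) • (cfc (fun t => k m t * (1 - k (n + 1) t * k (n + 1) t)) b * y) := by
        rw [cfc_mul .., cfc_sub .., cfc_mul .., cfc_const_one ..]
        simp only [Complex.ofReal_add, Complex.ofReal_one, add_smul, one_smul, mul_add,
          mul_smul_comm, mul_sub, sub_mul, mul_one, smul_sub, mul_assoc]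
        abel
      have e2 : ‖y + cfc (k (n + 1)) b * ((r : ℂ) • (cfc (k (n + 1)) b * y))‖ ≤
          √(R ^ 2 + r ^ 2 * B) := by
        refine Real.le_sqrt_of_sq_le ?_
        refine (SigmaTendsto.norm_add_mul_sq_le hx hy _ _ (norm_cfc_mul_self_add_le_one hf
          (hk _) (fun t => ?_) (hfk _) hf1)).trans ?_
        · rw [abs_of_nonneg (hk0 _ t)]; exact hk1 _ t
        · rw [norm_smul, mul_pow, Complex.norm_real, Real.norm_eq_abs, sq_abs]
          gcongr
          exact hB _
      have e3 : ‖cfc (fun t => k m t * (1 - k (n + 1) t * k (n + 1) t)) b‖ ≤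
          m * (1 / ((n : ℝ) + 1)) := by
        refine norm_cfc_le (by positivity) fun t _ => ?_
        have hkk : k (n + 1) t * k (n + 1) t ≤ 1 := mul_le_one₀ (hk1 _ t) (hk0 _ t) (hk1 _ t)
        rw [Real.norm_eq_abs, abs_of_nonneg (mul_nonneg (hk0 m t) (by linarith))]
        rcases le_total 1 (((n + 1 : ℕ) : ℝ) * h t) with hc | hc
        · have : k (n + 1) t = 1 := min_eq_left hc
          rw [this]; simp; positivity
        · calc k m t * (1 - k (n + 1) t * k (n + 1) t) ≤ k m t * 1 := by
                gcongr
                · exact hk0 m t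
                · linarith [mul_self_nonneg (k (n + 1) t)]
            _ ≤ m * h t := by rw [mul_one]; exact min_le_right _ _
            _ ≤ m * (1 / ((n : ℝ) + 1)) := by
                gcongr
                rw [le_div_iff₀ (by positivity), mul_comm]
                simpa using hc
      calc (1 + r) * ‖cfc (k m) b * y‖ = ‖((1 + r : ℝ) : ℂ) • (cfc (k m) b * y)‖ := by
            rw [norm_smul, Complex.norm_real, Real.norm_eq_abs, abs_of_nonneg (by positivity)]
        _ ≤ 1 * √(R ^ 2 + r ^ 2 * B) + r * ((m * (1 / ((n : ℝ) + 1))) * ‖y‖) := by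
            rw [e1]
            refine (norm_add_le _ _).trans (add_le_add ((norm_mul_le _ _).trans ?_) ?_)
            · exact mul_le_mul (hnorm m) e2 (norm_nonneg _) zero_le_one
            · rw [norm_smul, Complex.norm_real, Real.norm_eq_abs, abs_of_nonneg hr]
              gcongr
              exact (norm_mul_le _ _).trans (by gcongr)
        _ = _ := by ring
    have lim : Tendsto (fun n : ℕ => √(R ^ 2 + r ^ 2 * B) + r * (m * (1 / ((n : ℝ) + 1))) * ‖y‖)
        atTop (𝓝 (√(R ^ 2 + r ^ 2 * B) + r * (m * 0) * ‖y‖)) :=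
      tendsto_const_nhds.add (((tendsto_one_div_add_atTop_nhds_zero_nat.const_mul _).const_mul
        _).mul_const _)
    have := ge_of_tendsto' lim main
    simp only [mul_zero, zero_mul, add_zero] at this
    rw [← mul_pow]
    exact (Real.le_sqrt (by positivity) (by have := (sq_nonneg _).trans (hB m); positivity)).1 this
  have hbdd : BddAbove (Set.range fun m => ‖cfc (k m) b * y‖ ^ 2) := by
    refine ⟨‖y‖ ^ 2, ?_⟩
    rintro _ ⟨m, rfl⟩
    have : ‖cfc (k m) b * y‖ ≤ ‖y‖ :=
      (norm_mul_le _ _).trans (mul_le_of_le_one_left (norm_nonneg _) (hnorm m))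
    dsimp only
    gcongr
  set B := ⨆ m, ‖cfc (k m) b * y‖ ^ 2 with hBdef
  have hle : ∀ m, ‖cfc (k m) b * y‖ ^ 2 ≤ B := fun m => le_ciSup hbdd m
  have hB : ∀ r : ℝ, 0 ≤ r → (1 + r) ^ 2 * B ≤ R ^ 2 + r ^ 2 * B := by
    intro r hr
    have : B ≤ (R ^ 2 + r ^ 2 * B) / (1 + r) ^ 2 := ciSup_le fun m => by
      rw [le_div_iff₀ (by positivity), mul_comm]
      exact step B hle m r hr
    rw [le_div_iff₀ (by positivity)] at this
    linarith
  -- `hB` amounts to `(1 + 2r) B ≤ R²` for every `r ≥ 0`; if `B > 0`, the choice `r = R² / B`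
  -- contradicts it.
  have hB0 : B ≤ 0 := by
    by_contra! hpos
    have := hB (R ^ 2 / B) (by positivity)
    have h2 : R ^ 2 / B * B = R ^ 2 := by field_simp
    nlinarith [sq_nonneg R]
  have h3 : k 1 = h := by ext t; simp [k, h1 t]
  have h4 := hle 1
  rw [h3] at h4
  have : ‖cfc h b * y‖ ^ 2 = 0 := le_antisymm (h4.trans hB0) (sq_nonneg _)
  simpa using this

end

end FourierStieltjes

/-! ### Weak continuity of multiplication and involution -/

namespace FourierStieltjes

open Filter Topology

section

variable {M X : Type u} [CStarAlgebra M] [NormedAddCommGroup X]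
  [NormedSpace ℂ X] {e : M ≃ₗᵢ[ℂ] StrongDual ℂ X} {ι : Type*}

/-- The bump functions at the points `k / n`; they sum to `1` on `[0, 1]`. -/
noncomputable def bump (n k : ℕ) (t : ℝ) : ℝ :=
  max 0 (min 1 (n * t - k + 1)) - max 0 (min 1 (n * t - k))

theorem continuous_bump (n k : ℕ) : Continuous (bump n k) := by
  unfold bump; fun_prop

theorem bump_nonneg (n k : ℕ) (t : ℝ) : 0 ≤ bump n k t := by
  unfold bump
  rw [sub_nonneg]
  gcongr
  linarith

theorem bump_le_one (n k : ℕ) (t : ℝ) : bump n k t ≤ 1 := by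
  unfold bump
  have h1 : max 0 (min 1 (n * t - k + 1)) ≤ 1 := max_le zero_le_one (min_le_left _ _)
  have h2 : 0 ≤ max 0 (min 1 (n * t - k)) := le_max_left _ _
  linarith

theorem bump_eq_zero {n k : ℕ} {t : ℝ} (h : 1 ≤ |n * t - k|) : bump n k t = 0 := by
  unfold bump
  rcases le_abs.1 h with h | h
  · rw [min_eq_left h, min_eq_left (by linarith), sub_self]
  · rw [max_eq_left (min_le_of_right_le (by linarith)),
      max_eq_left (min_le_of_right_le (by linarith)), sub_self]

theorem sum_bump (n : ℕ) {t : ℝ} (h0 : 0 ≤ t) (h1 : t ≤ 1) :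
    ∑ k ∈ Finset.range (n + 1), bump n k t = 1 := by
  have := Finset.sum_range_sub' (fun k : ℕ => max 0 (min 1 (n * t - k + 1))) (n + 1)
  have h2 : ∀ k : ℕ, n * t - ((k + 1 : ℕ) : ℝ) + 1 = n * t - k := fun k => by push_cast; ring
  simp only [h2] at this
  unfold bump
  rw [this]
  have h3 : n * t ≤ n := mul_le_of_le_one_right n.cast_nonneg h1
  have h4 : 0 ≤ n * t := by positivity
  rw [min_eq_left (by simpa using h4), max_eq_right zero_le_one,
    max_eq_left (min_le_of_right_le (by linarith)), sub_zero]

/-- On the support of the bump, `b` is within `1 / n` of the scalar `k / n`. Write `b = k/n + f(b) +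
p(b)`: the scalar part contributes nothing because `x i` tends to `0`, the part `f(b)` is killed by
locality, and `p(b)` has norm at most `1 / n`. -/
theorem norm_cfc_bump_mul_le {U : Ultrafilter ι} {x : ι → M} {R : ℝ}
    (hx : ∀ᶠ i in U, ‖x i‖ ≤ R) (hx0 : SigmaTendsto e U x 0) {b : M} (hb : IsSelfAdjoint b)
    (hspec : spectrum ℝ b ⊆ Set.Icc 0 1) {y : M} (hy : SigmaTendsto e U (fun i => b * x i) y)
    {n k : ℕ} (hn : 0 < n) (hk : k ≤ n) :
    ‖cfc (fun t => √(bump n k t)) b * y‖ ≤ R / n := by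
  have hn' : (0 : ℝ) < n := by exact_mod_cast hn
  have hkn : (k : ℝ) / n ≤ 1 := by rw [div_le_one hn']; exact_mod_cast hk
  have hkn0 : 0 ≤ (k : ℝ) / n := by positivity
  -- `p` truncates `t - k/n` to `[-1/n, 1/n]`, so the remainder `f` vanishes wherever the bump does
  -- not.
  let p : ℝ → ℝ := fun t => max (-(1 / n)) (min (1 / n) (t - k / n))
  let f : ℝ → ℝ := fun t => t - k / n - p t
  have hp : Continuous p := by fun_prop
  have hf : Continuous f := by fun_prop
  have hpn : ∀ t, |p t| ≤ 1 / n := fun t =>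
    abs_le.2 ⟨le_max_left _ _, max_le (by linarith [one_div_pos.2 hn']) (min_le_left _ _)⟩
  have hnorm : ‖cfc p b‖ ≤ 1 / n := norm_cfc_le (by positivity) fun t _ => hpn t
  have hmul : ∀ᶠ i in U, ‖cfc p b * x i‖ ≤ R / n := hx.mono fun i hi => by
    refine (norm_mul_le _ _).trans ?_
    rw [div_eq_mul_one_div, mul_comm]
    exact mul_le_mul hi hnorm (norm_nonneg _) ((norm_nonneg _).trans hi)
  have hmul' : ∀ᶠ i in U, ‖cfc f b * x i‖ ≤ ‖cfc f b‖ * R := hx.mono fun i hi =>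
    (norm_mul_le _ _).trans (by gcongr)
  obtain ⟨y₂, hy₂⟩ := exists_sigmaTendsto (e := e) U hmul
  obtain ⟨y₁, hy₁⟩ := exists_sigmaTendsto (e := e) U hmul'
  have hsum : y = y₁ + y₂ := by
    refine hy.unique (l := (U : Filter ι)) ?_
    have h3 := (hy₁.add hy₂).add (hx0.smul (((k : ℝ) / n : ℝ) : ℂ))
    rw [smul_zero, add_zero] at h3
    convert h3 using 2 with i
    have : b = cfc f b + cfc p b + (((k : ℝ) / n : ℝ) : ℂ) • (1 : M) := by
      have h5 : (((k : ℝ) / n : ℝ) : ℂ) • (1 : M) = cfc (fun _ : ℝ => (k : ℝ) / n) b := by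
        rw [cfc_const .., Algebra.algebraMap_eq_smul_one, Complex.coe_smul]
      rw [h5, ← cfc_add .., ← cfc_add ..]
      conv_lhs => rw [← cfc_id ℝ b]
      refine cfc_congr fun t _ => ?_
      simp [f]
    conv_lhs => rw [this]
    simp [add_mul]
  have h1 : cfc (fun t => √(bump n k t)) b * y₁ = 0 := by
    refine cfc_mul_eq_zero_of_sigmaTendsto hx hb hf (continuous_bump n k).sqrt
      (fun t => Real.sqrt_nonneg _)
      (fun t => Real.sqrt_le_one.2 (bump_le_one n k t)) (fun t => ?_) (fun t ht => ?_) hy₁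
    · rcases le_total 1 |n * t - k| with h | h
      · rw [bump_eq_zero h, Real.sqrt_zero, mul_zero]
      · have h4 : |t - k / n| ≤ 1 / n := by
          rw [le_div_iff₀ hn', ← abs_of_pos hn', ← abs_mul, abs_of_pos hn']
          have : (t - k / n) * n = n * t - k := by field_simp
          rwa [this]
        have h5 : p t = t - k / n := by
          simp only [p]
          rw [min_eq_right (abs_le.1 h4).2, max_eq_right (abs_le.1 h4).1]
        simp [f, h5]
    · obtain ⟨ht0, ht1⟩ := hspec ht
      have hpos := one_div_pos.2 hn'
      simp only [f, p]
      rcases le_total (1 / (n : ℝ)) (t - k / n) with h | h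
      · rw [min_eq_left h, max_eq_right (by linarith), abs_le]
        constructor <;> linarith
      · rw [min_eq_right h]
        rcases le_total (-(1 / (n : ℝ))) (t - k / n) with h' | h'
        · rw [max_eq_right h']; simp
        · rw [max_eq_left h', abs_le]
          constructor <;> linarith
  rw [hsum, mul_add, h1, zero_add]
  have h2 : ‖y₂‖ ≤ R / n := hy₂.norm_le hmul
  refine (norm_mul_le _ _).trans ((mul_le_of_le_one_left (norm_nonneg _) ?_).trans h2)
  refine norm_cfc_le zero_le_one fun t _ => ?_
  rw [Real.norm_eq_abs, abs_of_nonneg (Real.sqrt_nonneg _)]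
  exact Real.sqrt_le_one.2 (bump_le_one n k t)

/-- With `N = n + 1`, the partition of unity splits `star y * y` into `N + 1` pieces, each of norm
at most `(R / N)²`. Their sum is of order `1 / N`, so `y = 0`. -/
theorem eq_zero_of_sigmaTendsto_mul {U : Ultrafilter ι} {x : ι → M} {R : ℝ}
    (hx : ∀ᶠ i in U, ‖x i‖ ≤ R) (hx0 : SigmaTendsto e U x 0) {b : M} (hb : IsSelfAdjoint b)
    (hspec : spectrum ℝ b ⊆ Set.Icc 0 1) {y : M}
    (hy : SigmaTendsto e U (fun i => b * x i) y) : y = 0 := by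
  have key : ∀ n : ℕ, ‖y‖ ^ 2 ≤ R ^ 2 * (2 * (1 / ((n : ℝ) + 1))) := by
    intro n
    have hdecomp : star y * y = ∑ k ∈ Finset.range (n + 1 + 1),
        star (cfc (fun t => √(bump (n + 1) k t)) b * y) *
          (cfc (fun t => √(bump (n + 1) k t)) b * y) := by
      have hone : ∑ k ∈ Finset.range (n + 1 + 1), cfc (bump (n + 1) k) b = 1 := by
        rw [← cfc_sum _ _ _ fun k _ => (continuous_bump (n + 1) k).continuousOn, ← cfc_one ℝ b]
        refine cfc_congr fun t ht => ?_
        rw [Finset.sum_apply]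
        exact sum_bump (n + 1) (hspec ht).1 (hspec ht).2
      have hsq : ∀ k, star (cfc (fun t => √(bump (n + 1) k t)) b * y) *
          (cfc (fun t => √(bump (n + 1) k t)) b * y) = star y * (cfc (bump (n + 1) k) b * y) := by
        intro k
        have hc := (continuous_bump (n + 1) k).sqrt
        rw [star_mul, (cfc_predicate (fun t => √(bump (n + 1) k t)) b : IsSelfAdjoint _).star_eq,
          mul_assoc, ← mul_assoc (cfc _ b), ← cfc_mul _ _ _ hc.continuousOn hc.continuousOn]
        simp only [Real.mul_self_sqrt (bump_nonneg _ _ _)]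
      simp only [hsq]
      rw [← Finset.mul_sum, ← Finset.sum_mul, hone, one_mul]
    have hR : 0 ≤ R := (hx.exists.choose_spec |> (norm_nonneg _).trans)
    rw [sq, ← CStarRing.norm_star_mul_self, hdecomp]
    calc _ ≤ ∑ k ∈ Finset.range (n + 1 + 1), (R / ((n + 1 : ℕ) : ℝ)) ^ 2 := by
          refine norm_sum_le_of_le _ fun k hk => ?_
          rw [CStarRing.norm_star_mul_self, ← sq]
          have := norm_cfc_bump_mul_le hx hx0 hb hspec hy n.succ_pos
            (Nat.lt_succ_iff.1 (Finset.mem_range.1 hk))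
          gcongr
      _ = R ^ 2 * (((n : ℝ) + 2) / (n + 1) * (1 / ((n : ℝ) + 1))) := by
          simp only [Finset.sum_const, Finset.card_range, nsmul_eq_mul]
          push_cast
          field_simp
          ring
      _ ≤ _ := by
          gcongr
          rw [div_le_iff₀ (by positivity)]
          have : (0 : ℝ) ≤ n := n.cast_nonneg
          linarith
  have lim : Tendsto (fun n : ℕ => R ^ 2 * (2 * (1 / ((n : ℝ) + 1)))) atTop
      (𝓝 (R ^ 2 * (2 * 0))) :=
    (tendsto_one_div_add_atTop_nhds_zero_nat.const_mul _).const_mul _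
  have := ge_of_tendsto' lim key
  have h : ‖y‖ ^ 2 = 0 := le_antisymm (by simpa using this) (sq_nonneg _)
  simpa using h

/-- Left multiplication in a W⋆-algebra is `σ`-continuous. -/
theorem exists_predual_mul_left [CompleteSpace X] (e : M ≃ₗᵢ[ℂ] StrongDual ℂ X) (a : M) (ψ : X) :
    ∃ φ : X, ∀ x, e (a * x) ψ = e x φ := by
  let _ := CStarAlgebra.spectralOrder M
  have := CStarAlgebra.spectralOrderedRing M
  -- The claim is linear in `a`, and positive contractions span.
  have ha : a ∈ Submodule.span ℂ ({x : M | 0 ≤ x} ∩ Metric.closedBall 0 1) := by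
    rw [CStarAlgebra.span_nonneg_inter_unitClosedBall]; trivial
  induction ha using Submodule.span_induction with
  | mem b hb =>
    obtain ⟨hb0, hb1⟩ := hb
    rw [mem_closedBall_zero_iff] at hb1
    let g : StrongDual ℂ M := (predualEmbedding e ψ).comp (ContinuousLinearMap.mul ℂ M b)
    refine exists_predual_of_tendsto_zero g fun U hU hU0 => ?_
    have hbU : ∀ᶠ x in (U : Filter M), ‖b * x‖ ≤ 1 := hU.mono fun x hx =>
      (norm_mul_le _ _).trans (mul_le_one₀ hb1 (norm_nonneg _) hx)
    obtain ⟨y, hy⟩ := exists_sigmaTendsto (e := e) U hbU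
    have hy0 : y = 0 := eq_zero_of_sigmaTendsto_mul hU hU0 (IsSelfAdjoint.of_nonneg hb0)
      (fun t ht => ⟨spectrum_nonneg_of_nonneg hb0 ht,
        (CFC.le_one_iff b).1 ((CStarAlgebra.norm_le_one_iff_of_nonneg b).1 hb1) t ht⟩) hy
    have := hy ψ
    rw [hy0, map_zero] at this
    exact this
  | zero => exact ⟨0, fun x => by simp⟩
  | add a b _ _ ha hb =>
    obtain ⟨φ, hφ⟩ := ha
    obtain ⟨φ', hφ'⟩ := hb
    exact ⟨φ + φ', fun x => by simp [add_mul, hφ, hφ']⟩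
  | smul c a _ ha =>
    obtain ⟨φ, hφ⟩ := ha
    exact ⟨c • φ, fun x => by simp [hφ]⟩

/-- Division by `c` gives `k ≤ B / c`; for large `c` this excludes any `t > 0` from the spectrum. -/
theorem nonpos_of_smul_le {A : Type*} [CStarAlgebra A] [PartialOrder A] [StarOrderedRing A]
    {k : A} (hk : IsSelfAdjoint k) {B : ℝ}
    (h : ∀ c : ℝ, 0 < c → c • k ≤ algebraMap ℝ A B) : k ≤ 0 := by
  have hB : ∀ c : ℝ, 0 < c → k ≤ algebraMap ℝ A (B / c) := fun c hc => by
    have := smul_le_smul_of_nonneg_left (h c hc) (inv_nonneg.2 hc.le)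
    rwa [smul_smul, inv_mul_cancel₀ hc.ne', one_smul, Algebra.smul_def, ← map_mul,
      mul_comm, ← div_eq_mul_inv] at this
  rw [← map_zero (algebraMap ℝ A), le_algebraMap_iff_spectrum_le hk]
  intro t ht
  by_contra! hpos
  have h1 := (le_algebraMap_iff_spectrum_le hk).1
    (hB ((|B| + 1) / t) (by positivity)) t ht
  rw [div_div_eq_mul_div, le_div_iff₀ (by positivity)] at h1
  nlinarith [le_abs_self B]

theorem star_mul_self_add_I_smul_one {A : Type*} [CStarAlgebra A] (z : A) (r : ℝ) :
    star (z + (Complex.I * r) • (1 : A)) * (z + (Complex.I * r) • (1 : A)) =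
      star z * z + r • (Complex.I • (star z - z)) + algebraMap ℝ A (r ^ 2) := by
  have h1 : (-Complex.I * r) • (Complex.I * r) • (1 : A) = algebraMap ℝ A (r ^ 2) := by
    rw [smul_smul, Algebra.algebraMap_eq_smul_one, ← Complex.coe_smul]
    congr 1
    push_cast
    linear_combination (-(r : ℂ) ^ 2) * Complex.I_sq
  have h2 : r • (Complex.I • (star z - z)) = (Complex.I * r) • star z + (-Complex.I * r) • z := by
    rw [← Complex.coe_smul]; module
  rw [h2, ← h1, star_add, star_smul, star_one]
  simp only [add_mul, mul_add, smul_mul_assoc, mul_smul_comm, one_mul, mul_one, star_mul',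
    Complex.star_def, Complex.conj_I, Complex.conj_ofReal]
  module

theorem norm_one_le {A : Type*} [CStarAlgebra A] : ‖(1 : A)‖ ≤ 1 := by
  rw [← cfc_one ℝ (0 : A)]
  exact norm_cfc_le zero_le_one fun t _ => by simp

/-- Validity of such a bound for all real `r` forces self-adjointness. Being a pure norm condition,
it passes to `σ`-limits, unlike the equation `star h = h` at this stage. -/
theorem norm_add_I_smul_one_sq_le {A : Type*} [CStarAlgebra A] {h : A} (hh : IsSelfAdjoint h)
    (r : ℝ) : ‖h + (Complex.I * r) • (1 : A)‖ ^ 2 ≤ ‖h‖ ^ 2 + r ^ 2 := by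
  rw [sq, ← CStarRing.norm_star_mul_self, star_mul_self_add_I_smul_one, hh.star_eq, sub_self,
    smul_zero, smul_zero, add_zero, sq ‖h‖]
  refine (norm_add_le _ _).trans (add_le_add (norm_mul_le _ _) ?_)
  rw [norm_algebraMap, Real.norm_eq_abs, abs_of_nonneg (sq_nonneg r)]
  exact mul_le_of_le_one_right (sq_nonneg r) norm_one_le

/-- Weak limits of bounded families of self-adjoint elements are self-adjoint. -/
theorem SigmaTendsto.isSelfAdjoint {l : Filter ι} [l.NeBot] {x : ι → M} {R : ℝ}
    (hx : ∀ᶠ i in l, ‖x i‖ ≤ R) (hsa : ∀ i, IsSelfAdjoint (x i)) {y : M}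
    (hy : SigmaTendsto e l x y) : IsSelfAdjoint y := by
  let _ := CStarAlgebra.spectralOrder M
  have := CStarAlgebra.spectralOrderedRing M
  have norm_le : ∀ r : ℝ, ‖y + (Complex.I * r) • (1 : M)‖ ^ 2 ≤ R ^ 2 + r ^ 2 := by
    intro r
    have hR : 0 ≤ R ^ 2 + r ^ 2 := by positivity
    refine (Real.le_sqrt (norm_nonneg _) hR).1 <|
      (hy.add (SigmaTendsto.const _)).norm_le (hx.mono fun i hi => ?_)
    refine Real.le_sqrt_of_sq_le ?_
    refine (norm_add_I_smul_one_sq_le (hsa i) r).trans ?_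
    gcongr
  have hk : IsSelfAdjoint (Complex.I • (star y - y)) := by
    rw [IsSelfAdjoint, star_smul, star_sub, star_star, Complex.star_def, Complex.conj_I]
    module
  -- The quadratic terms in `r` cancel, leaving a bound linear in `r`. Both signs of `r` then force
  -- `Complex.I • (star y - y) = 0`.
  have bound : ∀ r : ℝ, r • (Complex.I • (star y - y)) ≤ algebraMap ℝ M (R ^ 2) := by
    intro r
    have h1 : star (y + (Complex.I * r) • (1 : M)) * (y + (Complex.I * r) • (1 : M)) ≤
        algebraMap ℝ M (R ^ 2 + r ^ 2) :=
      CStarAlgebra.star_mul_le_algebraMap_norm_sq.trans (algebraMap_mono M (norm_le r))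
    rw [star_mul_self_add_I_smul_one, map_add, add_le_add_iff_right] at h1
    exact (le_add_of_nonneg_left (star_mul_self_nonneg y)).trans h1
  have h1 := nonpos_of_smul_le hk fun c _ => bound c
  have h2 := nonpos_of_smul_le hk.neg fun c _ => by
    rw [smul_neg, ← neg_smul]; exact bound (-c)
  have h3 := le_antisymm h1 (neg_nonpos.1 h2)
  have h4 := (smul_eq_zero.1 h3).resolve_left Complex.I_ne_zero
  exact sub_eq_zero.1 h4

variable [CompleteSpace X]

/-- The involution of a W⋆-algebra is `σ`-continuous. -/
theorem exists_predual_star (e : M ≃ₗᵢ[ℂ] StrongDual ℂ X) (ψ : X) :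
    ∃ φ : X, ∀ x, star (e (star x) ψ) = e x φ := by
  let g : StrongDual ℂ M := LinearMap.mkContinuous
    { toFun := fun x => star (e (star x) ψ)
      map_add' := fun x y => by simp
      map_smul' := fun c x => by simp } ‖ψ‖ fun x => by
        simpa [mul_comm] using (e (star x)).le_opNorm ψ
  refine exists_predual_of_tendsto_zero g fun U hU hU0 => ?_
  have hsU : ∀ᶠ x in (U : Filter M), ‖star x‖ ≤ 1 := by simpa using hU
  obtain ⟨y, hy⟩ := exists_sigmaTendsto (e := e) U hsU
  -- As `x` tends to `0`, `y` is the limit of `x + star x` and `Complex.I • y` that of `Complex.I •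
  -- (star x - x)`. Both are self-adjoint, which is possible only for `y = 0`.
  have h1 : IsSelfAdjoint y := by
    have h := hU0.add hy
    rw [zero_add] at h
    refine SigmaTendsto.isSelfAdjoint (R := 1 + 1) (hU.mono fun x hx => ?_)
      (fun x => IsSelfAdjoint.add_star_self x) h
    exact (norm_add_le _ _).trans (add_le_add hx (by rwa [norm_star]))
  have h2 : IsSelfAdjoint (Complex.I • y) := by
    have h := (hy.sub hU0).smul Complex.I
    rw [sub_zero] at h
    refine SigmaTendsto.isSelfAdjoint (R := 1 + 1) (hU.mono fun x hx => ?_) (fun x => ?_) h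
    · rw [norm_smul, Complex.norm_I, one_mul]
      exact (norm_sub_le _ _).trans (add_le_add (by rwa [norm_star]) hx)
    · rw [IsSelfAdjoint, star_smul, star_sub, star_star, Complex.star_def, Complex.conj_I]
      simp only [id]
      module
  have h0 : y = 0 := by
    rw [IsSelfAdjoint, star_smul, h1.star_eq, Complex.star_def, Complex.conj_I, neg_smul] at h2
    have h3 : (2 * Complex.I) • y = 0 := by
      rw [mul_smul, two_smul]
      nth_rewrite 1 [← h2]
      exact neg_add_cancel _
    exact (smul_eq_zero.1 h3).resolve_left (by simp)
  have := (hy ψ).star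
  rw [h0, map_zero, zero_apply, star_zero] at this
  exact this

/-- Right multiplication in a W⋆-algebra is `σ`-continuous. -/
theorem exists_predual_mul_right (e : M ≃ₗᵢ[ℂ] StrongDual ℂ X) (a : M) (ψ : X) :
    ∃ φ : X, ∀ x, e (x * a) ψ = e x φ := by
  obtain ⟨ψ₁, h₁⟩ := exists_predual_star e ψ
  obtain ⟨ψ₂, h₂⟩ := exists_predual_mul_left e (star a) ψ₁
  obtain ⟨ψ₃, h₃⟩ := exists_predual_star e ψ₂
  refine ⟨ψ₃, fun x => ?_⟩
  rw [← h₃, ← h₂, ← h₁, star_star, star_mul, star_star, star_star]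

end

end FourierStieltjes

/-! ### Positive functionals, polar decomposition and Gram kernels -/

namespace FourierStieltjes

open Filter Topology Matrix
open scoped ComplexOrder InnerProductSpace ComplexConjugate

/-- A bounded functional on a C⋆-algebra that attains its norm at `1` is positive. -/
theorem nonneg_of_norm_le {A : Type*} [CStarAlgebra A] [PartialOrder A] [StarOrderedRing A]
    {φ : StrongDual ℂ A} {r : ℝ} (hφ : ∀ x, ‖φ x‖ ≤ r * ‖x‖) (h1 : φ 1 = r) {a : A}
    (ha : 0 ≤ a) : 0 ≤ φ a := by
  have hr : 0 ≤ r := by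
    by_contra! hr
    have h2 := hφ 1
    rw [h1, Complex.norm_real, Real.norm_eq_abs, abs_of_neg hr] at h2
    nlinarith [norm_nonneg (1 : A), norm_one_le (A := A)]
  set c := ‖a‖ with hc
  have hsa : IsSelfAdjoint a := IsSelfAdjoint.of_nonneg ha
  -- Centring the spectrum of `a`, which lies in `[0, c]`, halves the norm bound; this yields `0 ≤
  -- (φ a).re` at the end.
  set b := a - algebraMap ℝ A (c / 2) with hb
  have hbsa : IsSelfAdjoint b := hsa.sub (IsSelfAdjoint.algebraMap A (IsSelfAdjoint.all (c / 2)))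
  have hbn : ‖b‖ ≤ c / 2 := by
    have h2 : b = cfc (fun t : ℝ => t - c / 2) a := by
      rw [cfc_sub .., cfc_const .., cfc_id' ..]
    rw [h2]
    refine norm_cfc_le (by positivity) fun t ht => ?_
    have ht0 := spectrum_nonneg_of_nonneg ha ht
    have ht1 := (le_algebraMap_iff_spectrum_le hsa).1 (hsa.le_algebraMap_norm_self) t ht
    rw [Real.norm_eq_abs, abs_le]
    constructor <;> linarith
  have hφb : φ a = φ b + r * (c / 2 : ℝ) := by
    rw [hb, map_sub, Algebra.algebraMap_eq_smul_one, ← Complex.coe_smul, map_smul, h1]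
    simp only [smul_eq_mul]; ring
  have key : ∀ n : ℝ, (φ b).re ^ 2 + ((φ b).im + n * r) ^ 2 ≤ r ^ 2 * (c ^ 2 / 4 + n ^ 2) := by
    intro n
    have h2 := hφ (b + (Complex.I * n) • (1 : A))
    have h3 := norm_add_I_smul_one_sq_le hbsa n
    have h4 : ‖φ (b + (Complex.I * n) • (1 : A))‖ ^ 2 = (φ b).re ^ 2 + ((φ b).im + n * r) ^ 2 := by
      rw [map_add, map_smul, h1, Complex.sq_norm, Complex.normSq_apply]
      simp
      ring
    rw [← h4]
    calc _ ≤ (r * ‖b + (Complex.I * n) • (1 : A)‖) ^ 2 := by gcongr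
      _ = r ^ 2 * ‖b + (Complex.I * n) • (1 : A)‖ ^ 2 := by ring
      _ ≤ r ^ 2 * (‖b‖ ^ 2 + n ^ 2) := by gcongr
      _ ≤ r ^ 2 * ((c / 2) ^ 2 + n ^ 2) := by gcongr
      _ = _ := by ring
  -- The `n²` terms cancel in `key`; what remains is linear in `n` and bounded, so `(φ b).im = 0`.
  have hlin : ∀ n : ℝ, 2 * n * r * (φ b).im ≤ r ^ 2 * (c ^ 2 / 4) := fun n => by
    nlinarith [key n, sq_nonneg (φ b).re, sq_nonneg (φ b).im]
  have him : (φ b).im = 0 := by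
    rcases hr.eq_or_lt with h0 | hpos
    · have := key 0
      rw [← h0] at this
      nlinarith [sq_nonneg (φ b).re, sq_nonneg (φ b).im]
    · by_contra hne
      have h5 := hlin ((r ^ 2 * (c ^ 2 / 4) + 1) / (2 * r * (φ b).im))
      have h6 : 2 * ((r ^ 2 * (c ^ 2 / 4) + 1) / (2 * r * (φ b).im)) * r * (φ b).im =
          r ^ 2 * (c ^ 2 / 4) + 1 := by field_simp
      linarith
  have hre : -(r * (c / 2)) ≤ (φ b).re := by
    have h5 := key 0
    have h6 : (φ b).re ^ 2 ≤ (r * (c / 2)) ^ 2 := by nlinarith [sq_nonneg (φ b).im]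
    exact (abs_le.1 (abs_le_of_sq_le_sq h6 (by positivity))).1
  rw [hφb, Complex.nonneg_iff]
  constructor
  · simp; linarith
  · simp [him]

/-- Polar decomposition: if a functional attains its norm at a contraction `u`, it is recovered
from its translate by `u`. -/
theorem apply_mul_star_mul {A : Type*} [CStarAlgebra A] {g : StrongDual ℂ A} {r : ℝ}
    (hg : ∀ x, ‖g x‖ ≤ r * ‖x‖) {u : A} (hu : ‖u‖ ≤ 1) (hgu : g u = r) (hr : 0 ≤ r) (x : A) :
    g (u * (star u * x)) = g x := by
  let _ := CStarAlgebra.spectralOrder A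
  have := CStarAlgebra.spectralOrderedRing A
  have hle : 0 ≤ 1 - u * star u := by
    rw [sub_nonneg]
    refine CStarAlgebra.mul_star_le_algebraMap_norm_sq.trans ?_
    rw [← map_one (algebraMap ℝ A)]
    exact algebraMap_mono A (pow_le_one₀ (norm_nonneg _) hu)
  set a := CFC.sqrt (1 - u * star u) with ha
  have haa : a * a = 1 - u * star u := CFC.sqrt_mul_sqrt_self _ hle
  have hasa : IsSelfAdjoint a := IsSelfAdjoint.of_nonneg (CFC.sqrt_nonneg _)
  -- Variational argument: moving from `u` in the direction `a * z`, with phase adjusted, raises `g`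
  -- to first order in `t`. Since `u * star u + a * a = 1`, the squared norm grows only to second
  -- order, so `g (a * z)` must vanish.
  have key : ∀ z, g (a * z) = 0 := by
    intro z
    rcases hr.eq_or_lt with h0 | hpos
    · have := hg (a * z)
      rw [← h0, zero_mul] at this
      simpa using this
    set G := ‖g (a * z)‖ ^ 2 with hG
    have hest : ∀ t : ℝ, 0 ≤ t → 2 * r * t * G ≤ r ^ 2 * t ^ 2 * G * ‖z‖ ^ 2 := by
      intro t ht
      have h1 := norm_mul_add_mul_sq_le u a 1 (((t : ℂ) * conj (g (a * z))) • z)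
      rw [hasa.star_eq, haa, add_sub_cancel, mul_one] at h1
      have h2 := hg (u + a * (((t : ℂ) * conj (g (a * z))) • z))
      have h3 : g (u + a * (((t : ℂ) * conj (g (a * z))) • z)) = ((r + t * G : ℝ) : ℂ) := by
        rw [map_add, mul_smul_comm, map_smul, hgu, smul_eq_mul, mul_assoc,
          ← Complex.normSq_eq_conj_mul_self, Complex.normSq_eq_norm_sq]
        rw [hG]
        push_cast
        rfl
      have h4 : 0 ≤ r + t * G := by positivity
      rw [h3, Complex.norm_real, Real.norm_eq_abs, abs_of_nonneg h4] at h2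
      have h5 : ‖(1 : A)‖ ^ 2 ≤ 1 := pow_le_one₀ (norm_nonneg _) norm_one_le
      have h6 : ‖((t : ℂ) * conj (g (a * z))) • z‖ ^ 2 = t ^ 2 * G * ‖z‖ ^ 2 := by
        rw [norm_smul, norm_mul, RCLike.norm_conj, Complex.norm_real, Real.norm_eq_abs, mul_pow,
          mul_pow, sq_abs]
      have h7 : ‖u + a * (((t : ℂ) * conj (g (a * z))) • z)‖ ^ 2 ≤ 1 + t ^ 2 * G * ‖z‖ ^ 2 := by
        refine h1.trans ((mul_le_of_le_one_left (by positivity) norm_one_le).trans ?_)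
        rw [h6]
        gcongr
      have h8 : (r + t * G) ^ 2 ≤ r ^ 2 * (1 + t ^ 2 * G * ‖z‖ ^ 2) := by
        calc _ ≤ (r * ‖u + a * (((t : ℂ) * conj (g (a * z))) • z)‖) ^ 2 := by gcongr
          _ = r ^ 2 * ‖u + a * (((t : ℂ) * conj (g (a * z))) • z)‖ ^ 2 := by ring
          _ ≤ _ := by gcongr
      nlinarith [sq_nonneg (t * G)]
    have hG0 : G = 0 := by
      by_contra hne
      have hGpos : 0 < G := lt_of_le_of_ne (sq_nonneg _) (Ne.symm hne)
      -- Any `t > 0` with `r ‖z‖² t < 2` would do; the added `1` covers `z = 0`.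
      set t := 1 / (r * ‖z‖ ^ 2 + 1) with ht
      have htpos : 0 < t := by positivity
      have h1 := hest t htpos.le
      have h2 : r * ‖z‖ ^ 2 * t ≤ 1 := by
        rw [ht, mul_one_div, div_le_one (by positivity)]; linarith
      have h3 : r * t * G * 2 ≤ r * t * G * (r * ‖z‖ ^ 2 * t) := by linarith
      have h4 := le_of_mul_le_mul_left h3 (by positivity)
      linarith
    simpa [hG] using hG0
  have h : x = u * (star u * x) + a * (a * x) := by
    rw [← mul_assoc, ← mul_assoc, haa, sub_mul, one_mul, add_sub_cancel]
  conv_rhs => rw [h]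
  rw [map_add, key, add_zero]

section Kernel

variable {J E E' : Type*} [SeminormedAddCommGroup E] [InnerProductSpace ℂ E]
  [SeminormedAddCommGroup E'] [InnerProductSpace ℂ E']

/-- Differences of Gram kernels are positive semidefinite when one dominates the other. -/
theorem posSemidef_inner_sub (T : E →ₗ[ℂ] E') {c : ℝ} (hT : ∀ x, ‖T x‖ ^ 2 ≤ c * ‖x‖ ^ 2)
    (v : J → E) :
    (of fun i j => (c : ℂ) * ⟪v i, v j⟫_ℂ - ⟪T (v i), T (v j)⟫_ℂ : Matrix J J ℂ).PosSemidef := by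
  refine ⟨?_, fun x => ?_⟩
  · ext i j
    simp [inner_conj_symm]
  · have h : (x.sum fun i xi => x.sum fun j xj => star xi *
        (of fun i j => (c : ℂ) * ⟪v i, v j⟫_ℂ - ⟪T (v i), T (v j)⟫_ℂ : Matrix J J ℂ) i j * xj) =
        c * ⟪x.sum fun i xi => xi • v i, x.sum fun i xi => xi • v i⟫_ℂ -
        ⟪T (x.sum fun i xi => xi • v i), T (x.sum fun i xi => xi • v i)⟫_ℂ := by
      simp only [Finsupp.sum, map_sum, map_smul, sum_inner, inner_sum, inner_smul_left,
        inner_smul_right, of_apply, Finset.mul_sum, ← Finset.sum_sub_distrib, Complex.star_def]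
      rw [Finset.sum_comm]
      refine Finset.sum_congr rfl fun i _ => Finset.sum_congr rfl fun j _ => ?_
      ring
    rw [h, inner_self_eq_norm_sq_to_K, inner_self_eq_norm_sq_to_K]
    simp only [RCLike.ofReal_eq_complex_ofReal]
    have := sub_nonneg.2 (hT (x.sum fun i xi => xi • v i))
    exact_mod_cast this

theorem posSemidef_inner (v : J → E) :
    (of fun i j => ⟪v i, v j⟫_ℂ : Matrix J J ℂ).PosSemidef := by
  simpa using posSemidef_inner_sub (0 : E →ₗ[ℂ] ℂ) (c := 1) (by simp) v

end Kernel

end FourierStieltjes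

/-! ### Coefficient functions and their products -/

namespace FourierStieltjes

open Filter Topology Matrix
open scoped ComplexOrder InnerProductSpace ComplexConjugate

theorem posSemidef_hadamard {J : Type*} {A B : Matrix J J ℂ} (hA : A.PosSemidef)
    (hB : B.PosSemidef) : (of fun i j => A i j * B i j : Matrix J J ℂ).PosSemidef :=
  hA.hadamard hB

section Semigroup

variable {S : Type u} [Semigroup S] [StarMul S] [TopologicalSpace S]

theorem SigmaRep.continuous_dualEquiv (α : SigmaRep S) (ψ : α.X) :
    @Continuous _ _ (sigma α.dualEquiv) _ fun x => α.dualEquiv x ψ :=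
  @Continuous.comp _ _ _ (sigma α.dualEquiv) _ _ _ _ (continuous_apply ψ) continuous_induced_dom

theorem SigmaRep.continuous_hat (α : SigmaRep S) (ψ : α.X) : Continuous (α.hat ψ) :=
  @Continuous.comp _ _ _ _ (sigma α.dualEquiv) _ _ _ (α.continuous_dualEquiv ψ) α.continuous_sigma

@[simp]
theorem SigmaRep.hat_add (α : SigmaRep S) (ψ φ : α.X) : α.hat (ψ + φ) = α.hat ψ + α.hat φ := by
  ext s; simp [SigmaRep.hat]

@[simp]
theorem SigmaRep.hat_sub (α : SigmaRep S) (ψ φ : α.X) : α.hat (ψ - φ) = α.hat ψ - α.hat φ := by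
  ext s; simp [SigmaRep.hat]

@[simp]
theorem SigmaRep.hat_smul (α : SigmaRep S) (c : ℂ) (ψ : α.X) : α.hat (c • ψ) = c • α.hat ψ := by
  ext s; simp [SigmaRep.hat]

theorem SigmaRep.eq_zero_of_hat_eq_zero (α : SigmaRep S) {ψ : α.X} (h : α.hat ψ = 0) :
    ψ = 0 := by
  have hcl : @IsClosed _ (sigma α.dualEquiv) {x | α.dualEquiv x ψ = 0} :=
    @IsClosed.preimage _ _ (sigma α.dualEquiv) _ _ (α.continuous_dualEquiv ψ) _
      (isClosed_singleton (x := (0 : ℂ)))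
  have hsub : (Submodule.span ℂ (Set.range α.ω) : Set α.M) ⊆ {x | α.dualEquiv x ψ = 0} := by
    have : Submodule.span ℂ (Set.range α.ω) ≤
        LinearMap.ker (predualEmbedding α.dualEquiv ψ : α.M →ₗ[ℂ] ℂ) := by
      rw [Submodule.span_le]
      rintro _ ⟨s, rfl⟩
      exact congrFun h s
    exact this
  have huniv : ∀ x, α.dualEquiv x ψ = 0 := fun x =>
    (@closure_minimal _ (sigma α.dualEquiv) _ _ hsub hcl) (α.dense_span x)
  refine (predualEmbedding α.dualEquiv).injective ?_
  ext x
  simpa using huniv x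

theorem SigmaRep.hat_injective (α : SigmaRep S) : Function.Injective α.hat := fun ψ φ h =>
  sub_eq_zero.1 <| α.eq_zero_of_hat_eq_zero <| by rw [α.hat_sub, h, sub_self]

end Semigroup

/-- Left multiplication by `ω 1` is `σ`-continuous and fixes `ω(S)`, whose span is dense; so it
fixes the identity of `M`. -/
theorem SigmaRep.map_one {S : Type u} [Monoid S] [StarMul S] [TopologicalSpace S]
    (α : SigmaRep S) : α.ω 1 = 1 := by
  refine α.dualEquiv.injective (ContinuousLinearMap.ext fun ψ => ?_)
  obtain ⟨φ, hφ⟩ := exists_predual_mul_left α.dualEquiv (α.ω 1) ψ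
  have : φ = ψ := α.hat_injective <| funext fun s => by
    rw [SigmaRep.hat, ← hφ, ← α.map_mul, _root_.one_mul]; rfl
  have h1 := hφ 1
  rwa [_root_.mul_one, this] at h1

section

variable {S : Type u} [Monoid S] [StarMul S] [TopologicalSpace S]

/-- `f` is a coefficient function of norm at most `r`: it is dominated by a continuous positive
definite function `p` with `p 1 = r` whose GNS representation is contractive. -/
structure IsCoefficient (f : S → ℂ) (r : ℝ) (p : S → ℂ) : Prop where
  continuous : Continuous p
  posSemidef : (of fun s t => p (star s * t) : Matrix S S ℂ).PosSemidef
  contractive : ∀ a, (of fun s t => p (star s * t) - p (star s * (star a * a) * t) :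
    Matrix S S ℂ).PosSemidef
  dominated : (of fun s t => (r : ℂ) * p (star s * t) - conj (f s) * f t :
    Matrix S S ℂ).PosSemidef
  map_one : p 1 = r

/-- Schur's product theorem for coefficient functions. -/
theorem IsCoefficient.mul {f g p q : S → ℂ} {r r' : ℝ} (hf : IsCoefficient f r p)
    (hg : IsCoefficient g r' q) :
    IsCoefficient (fun s => f s * g s) (r * r') (fun s => p s * q s) where
  continuous := hf.continuous.mul hg.continuous
  posSemidef := posSemidef_hadamard hf.posSemidef hg.posSemidef
  contractive a := by
    have h : (of fun s t => p (star s * (star a * a) * t) : Matrix S S ℂ).PosSemidef := by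
      convert hf.posSemidef.submatrix (fun s => a * s) using 1
      ext s t
      simp [mul_assoc]
    -- Writing `p'`, `q'` for the kernels translated by `a`: `p q - p' q' = (p - p') q + p' (q -
    -- q')`.
    convert (posSemidef_hadamard (hf.contractive a) hg.posSemidef).add
      (posSemidef_hadamard h (hg.contractive a)) using 1
    ext s t
    simp only [of_apply, Matrix.add_apply]
    ring
  dominated := by
    have h0 : 0 ≤ r' := by
      have := hg.posSemidef.diag_nonneg (i := 1)
      simpa [hg.map_one] using this
    have h : (of fun s t => conj (f s) * f t : Matrix S S ℂ).PosSemidef := by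
      convert posSemidef_inner f using 1
      ext s t
      simp [mul_comm]
    have h' : (of fun s t => (r' : ℂ) * q (star s * t) : Matrix S S ℂ).PosSemidef := by
      convert hg.posSemidef.smul (α := ℂ) (a := r') (by exact_mod_cast h0) using 1
      ext s t
      simp
    -- With `F = conj f ⊗ f` and `G = conj g ⊗ g`: `r r' p q - F G = (r p - F) r' q + F (r' q - G)`.
    convert (posSemidef_hadamard hf.dominated h').add (posSemidef_hadamard h hg.dominated) using 1
    ext s t
    simp only [of_apply, Matrix.add_apply, map_mul]
    push_cast
    ring
  map_one := by simp [hf.map_one, hg.map_one]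

theorem isCoefficient_one : IsCoefficient (fun _ : S => (1 : ℂ)) 1 (fun _ => 1) where
  continuous := continuous_const
  posSemidef := by
    convert posSemidef_inner (fun _ : S => (1 : ℂ)) using 1
    ext s t
    simp
  contractive a := by simpa using! PosSemidef.zero
  dominated := by simpa using! PosSemidef.zero
  map_one := by simp

/-- The functions `ψ̂` are coefficient functions. -/
theorem SigmaRep.exists_isCoefficient_hat (α : SigmaRep S) (ψ : α.X) :
    ∃ p, IsCoefficient (α.hat ψ) ‖ψ‖ p := by
  let _ := CStarAlgebra.spectralOrder α.M
  have := CStarAlgebra.spectralOrderedRing α.M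
  -- The unit ball of `M` is that of a dual space, so `ψ` attains its norm there.
  obtain ⟨u, hu, huψ⟩ : ∃ u : α.M, ‖u‖ ≤ 1 ∧ α.dualEquiv u ψ = ‖ψ‖ := by
    obtain ⟨g, hg, hgψ⟩ := exists_dual_vector'' ℂ ψ
    exact ⟨α.dualEquiv.symm g, by rwa [α.dualEquiv.symm.norm_map], by simpa using hgψ⟩
  set g := predualEmbedding α.dualEquiv ψ with hgdef
  have hg : ∀ x, ‖g x‖ ≤ ‖ψ‖ * ‖x‖ := fun x => by
    rw [← (predualEmbedding α.dualEquiv).norm_map ψ]; exact g.le_opNorm x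
  -- This plays the role of the absolute value of `ψ`. It attains its norm at `1`, so it is
  -- positive, and `p` is its coefficient.
  let φ : StrongDual ℂ α.M := g.comp (ContinuousLinearMap.mul ℂ α.M u)
  have hφ : ∀ x, ‖φ x‖ ≤ ‖ψ‖ * ‖x‖ := fun x => by
    refine (hg (u * x)).trans ?_
    gcongr
    exact (norm_mul_le _ _).trans (mul_le_of_le_one_left (norm_nonneg _) hu)
  have hφ1 : φ 1 = ‖ψ‖ := by
    change g (u * 1) = _
    rwa [mul_one]
  let Φ : α.M →ₚ[ℂ] ℂ := PositiveLinearMap.mk₀ (φ : α.M →ₗ[ℂ] ℂ) fun a ha =>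
    nonneg_of_norm_le hφ hφ1 ha
  have hΦ : ∀ x, Φ x = α.dualEquiv (u * x) ψ := fun x => rfl
  obtain ⟨ψ', hψ'⟩ := exists_predual_mul_left α.dualEquiv u ψ
  let v : S → Φ.PreGNS := fun s => Φ.toPreGNS (α.ω s)
  have hv : ∀ s t, ⟪v s, v t⟫_ℂ = Φ (α.ω (star s * t)) := fun s t => by
    rw [α.map_mul, α.map_star]; rfl
  refine ⟨fun s => Φ (α.ω s), ?_, ?_, fun a => ?_, ?_, ?_⟩
  · simp only [hΦ, hψ']
    exact α.continuous_hat ψ'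
  · simpa only [hv] using posSemidef_inner v
  · have hT : ∀ x, ‖(Φ.leftMulMapPreGNS (α.ω a) : Φ.PreGNS →ₗ[ℂ] Φ.PreGNS) x‖ ^ 2 ≤
        (1 : ℝ) * ‖x‖ ^ 2 := fun x => by
      rw [one_mul]
      gcongr
      refine ((Φ.leftMulMapPreGNS (α.ω a)).le_opNorm x).trans ?_
      refine mul_le_of_le_one_left (norm_nonneg _) (le_trans ?_ (α.norm_le_one a))
      exact LinearMap.mkContinuous_norm_le _ (norm_nonneg _) _
    convert posSemidef_inner_sub _ hT v using 1
    ext s t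
    have : ∀ s, Φ.leftMulMapPreGNS (α.ω a) (v s) = v (a * s) := fun s => by
      simp [v, α.map_mul]
    simp only [of_apply, ContinuousLinearMap.coe_coe, this, hv, star_mul, mul_assoc]
    simp
  · have hone : Φ 1 = ‖ψ‖ := hφ1
    -- In the GNS space of `Φ`, the functional `g` is the inner product with the class of `u`, whose
    -- squared norm is at most `‖ψ‖`. Cauchy–Schwarz then gives the domination.
    have hgu : ∀ x, ⟪Φ.toPreGNS u, x⟫_ℂ = g (Φ.ofPreGNS x) := fun x => by
      rw [PositiveLinearMap.preGNS_inner_def, hΦ]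
      exact apply_mul_star_mul hg hu huψ (norm_nonneg _) _
    have hun : ‖Φ.toPreGNS u‖ ^ 2 ≤ ‖ψ‖ := by
      have h1 := hgu (Φ.toPreGNS u)
      rw [inner_self_eq_norm_sq_to_K] at h1
      have h2 : ‖g u‖ = ‖ψ‖ := by
        have : g u = ‖ψ‖ := huψ
        rw [this]; simp
      rw [← h2]
      have := congrArg norm h1
      simpa using this.le
    have hT : ∀ x, ‖((g : α.M →ₗ[ℂ] ℂ) ∘ₗ Φ.ofPreGNS.toLinearMap) x‖ ^ 2 ≤ ‖ψ‖ * ‖x‖ ^ 2 :=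
      fun x => by
        have h1 := norm_inner_le_norm (𝕜 := ℂ) (Φ.toPreGNS u) x
        rw [hgu] at h1
        calc _ ≤ (‖Φ.toPreGNS u‖ * ‖x‖) ^ 2 := by gcongr; exact h1
          _ = ‖Φ.toPreGNS u‖ ^ 2 * ‖x‖ ^ 2 := by ring
          _ ≤ _ := by gcongr
    convert posSemidef_inner_sub _ hT v using 1
    ext s t
    have : ∀ s, ((g : α.M →ₗ[ℂ] ℂ) ∘ₗ Φ.ofPreGNS.toLinearMap) (v s) = α.hat ψ s := fun s => rfl
    simp only [of_apply, this, hv]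
    simp [mul_comm]
  · rw [α.map_one]; exact hφ1

end

end FourierStieltjes

/-! ### Weak density and the predual of `B(H)` -/

namespace FourierStieltjes

open Filter Topology
open scoped ComplexOrder InnerProductSpace ComplexConjugate

/-- A subspace of a dual Banach space without annihilator in the predual is `σ`-dense. -/
theorem dense_sigma {M X : Type u} [CStarAlgebra M] [NormedAddCommGroup X] [NormedSpace ℂ X]
    (e : M ≃ₗᵢ[ℂ] StrongDual ℂ X) (D : Submodule ℂ M)
    (h : ∀ ψ : X, (∀ x ∈ D, e x ψ = 0) → ψ = 0) : @Dense M (sigma e) (D : Set M) := by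
  classical
  let _ := sigma e
  intro x
  rw [mem_closure_iff_nhds]
  intro t ht
  rw [nhds_induced, mem_comap] at ht
  obtain ⟨t', ht', hsub⟩ := ht
  rw [nhds_pi, mem_pi] at ht'
  obtain ⟨I, hI, s, hs, hIs⟩ := ht'
  have := hI.fintype
  let L : M →ₗ[ℂ] (I → ℂ) :=
    LinearMap.pi fun ψ => (predualEmbedding e ψ.1 : M →ₗ[ℂ] ℂ)
  -- A basic neighbourhood sees only finitely many coordinates. If `L x` were outside `L(D)`, a
  -- separating functional on the finite-dimensional space would be a predual element annihilating
  -- `D` but not `x`.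
  have hmem : L x ∈ D.map L := by
    by_contra hx
    obtain ⟨g, hg, hgD⟩ := Submodule.exists_le_ker_of_notMem hx
    have hgsum : ∀ z, g (L z) = e z (∑ ψ : I, g (fun i => if ψ = i then 1 else 0) • ψ.1) := by
      intro z
      rw [LinearMap.pi_apply_eq_sum_univ g (L z)]
      simp [L, mul_comm]
    have h0 := h (∑ ψ : I, g (fun i => if ψ = i then 1 else 0) • ψ.1) fun z hz => by
      rw [← hgsum]; exact hgD (Submodule.mem_map_of_mem hz)
    exact hg (by rw [hgsum, h0, map_zero])
  obtain ⟨z, hz, hzx⟩ := hmem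
  refine ⟨z, hsub (hIs fun ψ hψ => ?_), hz⟩
  have h1 : e z ψ = e x ψ := congrFun hzx ⟨ψ, hψ⟩
  change e z ψ ∈ s ψ
  rw [h1]
  exact mem_of_mem_nhds (hs ψ)

section Normal

/-- Used inside the dual of `B(H)` to build the predual. The last clause is an induction principle:
closed linear conditions need only be checked on the generators. -/
theorem exists_closed_span {E : Type u} [NormedAddCommGroup E] [NormedSpace ℂ E] [CompleteSpace E]
    (s : Set E) : ∃ (Y : Type u) (_ : NormedAddCommGroup Y) (_ : NormedSpace ℂ Y)
      (_ : CompleteSpace Y) (j : Y →ₗᵢ[ℂ] E), (∀ x ∈ s, ∃ v, j v = x) ∧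
      ∀ Q : Submodule ℂ Y, IsClosed (Q : Set Y) → (∀ v, j v ∈ s → v ∈ Q) → Q = ⊤ := by
  let V := (Submodule.span ℂ s).topologicalClosure
  have hV : IsClosed (V : Set E) := Submodule.isClosed_topologicalClosure _
  refine ⟨V, inferInstance, inferInstance, hV.completeSpace_coe, V.subtypeₗᵢ, fun x hx =>
    ⟨⟨x, Submodule.le_topologicalClosure _ (Submodule.subset_span hx)⟩, rfl⟩, fun Q hQ h => ?_⟩
  have hcl : IsClosed (Q.map V.subtype : Set E) := by
    rw [Submodule.map_coe]
    exact hV.isClosedEmbedding_subtypeVal.isClosedMap _ hQ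
  have hle : V ≤ Q.map V.subtype := Submodule.topologicalClosure_minimal _
    (Submodule.span_le.2 fun x hx => ⟨⟨x, Submodule.le_topologicalClosure _
      (Submodule.subset_span hx)⟩, h _ hx, rfl⟩) hcl
  rw [Submodule.eq_top_iff']
  intro v
  obtain ⟨w, hw, hwv⟩ := hle v.2
  rwa [← Subtype.ext hwv]

variable {H : Type u} [NormedAddCommGroup H] [InnerProductSpace ℂ H]

/-- The vector functional `A ↦ ⟪x, A y⟫`. -/
noncomputable def vectorFunctional (x y : H) : StrongDual ℂ (H →L[ℂ] H) :=
  (innerSL ℂ x).comp (ContinuousLinearMap.apply ℂ H y)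

@[simp]
theorem vectorFunctional_apply (x y : H) (A : H →L[ℂ] H) :
    vectorFunctional x y A = ⟪x, A y⟫_ℂ := rfl

theorem norm_vectorFunctional_le (x y : H) : ‖vectorFunctional x y‖ ≤ ‖x‖ * ‖y‖ := by
  refine ContinuousLinearMap.opNorm_le_bound _ (by positivity) fun A => ?_
  rw [vectorFunctional_apply]
  calc ‖⟪x, A y⟫_ℂ‖ ≤ ‖x‖ * ‖A y‖ := norm_inner_le_norm _ _
    _ ≤ ‖x‖ * (‖A‖ * ‖y‖) := by gcongr; exact A.le_opNorm y
    _ = _ := by ring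

variable [CompleteSpace H]

/-- Bounded sesquilinear forms are given by operators. -/
theorem exists_operator_of_sesquilinear {Y : Type*} [NormedAddCommGroup Y] [NormedSpace ℂ Y]
    (w : H → H → Y) (hw : ∀ x y, ‖w x y‖ ≤ ‖x‖ * ‖y‖)
    (hadd : ∀ x x' y, w (x + x') y = w x y + w x' y)
    (hsmul : ∀ (c : ℂ) x y, w (c • x) y = conj c • w x y)
    (hadd' : ∀ x y y', w x (y + y') = w x y + w x y')
    (hsmul' : ∀ (c : ℂ) x y, w x (c • y) = c • w x y) (φ : StrongDual ℂ Y) :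
    ∃ A : H →L[ℂ] H, ‖A‖ ≤ ‖φ‖ ∧ ∀ x y, ⟪x, A y⟫_ℂ = φ (w x y) := by
  have hφ : ∀ x y, ‖φ (w x y)‖ ≤ ‖φ‖ * ‖x‖ * ‖y‖ := fun x y => by
    refine (φ.le_opNorm _).trans ?_
    rw [mul_assoc]
    gcongr
    exact hw x y
  let B : H →L⋆[ℂ] H →L[ℂ] ℂ := LinearMap.mkContinuous₂ (LinearMap.mk₂'ₛₗ (starRingEnd ℂ)
      (RingHom.id ℂ) (fun x y => φ (w x y))
    (fun x x' y => by simp only [hadd, map_add])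
    (fun c x y => by simp only [hsmul, map_smul])
    (fun x y y' => by simp only [hadd', map_add])
    (fun c x y => by simp only [hsmul', map_smul, RingHom.id_apply])) ‖φ‖ hφ
  refine ⟨(InnerProductSpace.continuousLinearMapOfBilin B).adjoint, ?_, fun x y => ?_⟩
  · rw [LinearIsometryEquiv.norm_map]
    refine ContinuousLinearMap.opNorm_le_bound _ (norm_nonneg _) fun x => ?_
    set z := InnerProductSpace.continuousLinearMapOfBilin B x with hz
    have h1 : ‖z‖ * ‖z‖ ≤ ‖φ‖ * ‖x‖ * ‖z‖ := by
      refine le_trans ?_ (hφ x z)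
      have : φ (w x z) = ⟪z, z⟫_ℂ := by
        conv_rhs => rw [hz, InnerProductSpace.continuousLinearMapOfBilin_apply]
        rfl
      rw [this, inner_self_eq_norm_sq_to_K]
      simp [sq]
    rcases (norm_nonneg z).eq_or_lt with h0 | h0
    · rw [← h0]; positivity
    · exact le_of_mul_le_mul_right h1 h0
  · rw [ContinuousLinearMap.adjoint_inner_right,
      InnerProductSpace.continuousLinearMapOfBilin_apply]
    rfl

variable (H) in
/-- `B(H)` is a dual Banach space, with a predual densely spanned by the vector functionals. -/
theorem exists_predual_operators : ∃ (Y : Type u) (_ : NormedAddCommGroup Y)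
    (_ : NormedSpace ℂ Y) (_ : CompleteSpace Y) (e : (H →L[ℂ] H) ≃ₗᵢ[ℂ] StrongDual ℂ Y)
    (w : H → H → Y), (∀ x y, ‖w x y‖ ≤ ‖x‖ * ‖y‖) ∧ (∀ A x y, e A (w x y) = ⟪x, A y⟫_ℂ) ∧
    ∀ Q : Submodule ℂ Y, IsClosed (Q : Set Y) → (∀ x y, w x y ∈ Q) → Q = ⊤ := by
  obtain ⟨Y, _, _, _, j, hj, hdense⟩ := exists_closed_span
    (Set.range fun p : H × H => vectorFunctional p.1 p.2)
  choose w hw using fun x y => hj (vectorFunctional x y) ⟨(x, y), rfl⟩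
  have hspan : ∀ Q : Submodule ℂ Y, IsClosed (Q : Set Y) → (∀ x y, w x y ∈ Q) → Q = ⊤ := by
    refine fun Q hQ h => hdense Q hQ fun v hv => ?_
    obtain ⟨p, hp⟩ := hv
    rw [← j.injective ((hw p.1 p.2).trans hp)]
    exact h _ _
  have hwn : ∀ x y, ‖w x y‖ ≤ ‖x‖ * ‖y‖ := fun x y => by
    rw [← j.norm_map, hw]; exact norm_vectorFunctional_le x y
  have ext : ∀ φ φ' : StrongDual ℂ Y, (∀ x y, φ (w x y) = φ' (w x y)) → φ = φ' := by
    intro φ φ' h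
    have := hspan (LinearMap.ker (φ - φ' : StrongDual ℂ Y).toLinearMap)
      (φ - φ').isClosed_ker fun x y => by simp [h]
    ext v
    have hv : v ∈ LinearMap.ker (φ - φ' : StrongDual ℂ Y).toLinearMap := by rw [this]; trivial
    simpa [sub_eq_zero] using hv
  let E₀ : (H →L[ℂ] H) →ₗ[ℂ] StrongDual ℂ Y :=
    { toFun := fun A => (NormedSpace.inclusionInDoubleDual ℂ (H →L[ℂ] H) A).comp
        j.toContinuousLinearMap
      map_add' := fun A B => by ext; simp
      map_smul' := fun c A => by ext; simp }
  have hE : ∀ A x y, E₀ A (w x y) = ⟪x, A y⟫_ℂ := fun A x y => by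
    change j (w x y) A = _
    rw [hw]; rfl
  have hop : ∀ φ : StrongDual ℂ Y, ∃ A : H →L[ℂ] H, ‖A‖ ≤ ‖φ‖ ∧ E₀ A = φ := by
    intro φ
    obtain ⟨A, hA, hAφ⟩ := exists_operator_of_sesquilinear w hwn
      (fun x x' y => j.injective (by ext A; simp [hw]))
      (fun c x y => j.injective (by ext A; simp [hw, mul_comm]))
      (fun x y y' => j.injective (by ext A; simp [hw]))
      (fun c x y => j.injective (by ext A; simp [hw])) φ
    exact ⟨A, hA, ext _ _ fun x y => by rw [hE, hAφ]⟩
  have hinj : Function.Injective E₀ := fun A B h => by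
    ext y
    refine ext_inner_left ℂ fun x => ?_
    rw [← hE, ← hE, h]
  have hnorm : ∀ A, ‖E₀ A‖ = ‖A‖ := by
    intro A
    refine le_antisymm (ContinuousLinearMap.opNorm_le_bound _ (norm_nonneg _) fun v => ?_) ?_
    · rw [mul_comm, ← j.norm_map v]
      exact (j v).le_opNorm A
    -- Rebuilding an operator from the functional `E₀ A` gives `A` back, with the reverse norm
    -- bound.
    · obtain ⟨B, hB, hBA⟩ := hop (E₀ A)
      rwa [hinj hBA] at hB
  refine ⟨Y, _, _, ‹_›, LinearIsometryEquiv.ofSurjective ⟨E₀, hnorm⟩ fun φ => ?_, w, hwn, hE, hspan⟩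
  obtain ⟨A, -, hA⟩ := hop φ
  exact ⟨A, hA⟩

end Normal

end FourierStieltjes

/-! ### Generated W⋆-algebras and elements of `Ω(S)` -/

namespace FourierStieltjes

open Filter Topology
open scoped ComplexOrder InnerProductSpace ComplexConjugate

section Generated

variable {B Y : Type u} [CStarAlgebra B] [NormedAddCommGroup Y] [NormedSpace ℂ Y]
  (e : B ≃ₗᵢ[ℂ] StrongDual ℂ Y)

/-- The elements of the predual that vanish on a set. -/
def preAnnihilator (s : Set B) : Submodule ℂ Y where
  carrier := {v | ∀ x ∈ s, e x v = 0}
  add_mem' hv hw x hx := by rw [map_add, hv x hx, hw x hx, add_zero]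
  zero_mem' x _ := map_zero _
  smul_mem' c v hv x hx := by rw [map_smul, hv x hx, smul_zero]

theorem mem_preAnnihilator {s : Set B} {v : Y} :
    v ∈ preAnnihilator e s ↔ ∀ x ∈ s, e x v = 0 := Iff.rfl

instance isClosed_preAnnihilator (s : Set B) : IsClosed (preAnnihilator e s : Set Y) := by
  have : (preAnnihilator e s : Set Y) = ⋂ x ∈ s, {v | e x v = 0} := by
    ext v; simp [mem_preAnnihilator]
  rw [this]
  exact isClosed_biInter fun x _ => isClosed_eq (e x).continuous continuous_const

/-- The W⋆-algebra generated by a self-adjoint multiplicative set containing `1`: its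
bipolar. -/
def generated [CompleteSpace Y] (s : Submonoid B) (hs : ∀ x ∈ s, star x ∈ s) :
    StarSubalgebra ℂ B where
  carrier := {x | ∀ v ∈ preAnnihilator e s, e x v = 0}
  mul_mem' := by
    intro x y hx hy v hv
    -- Closure under products in two stages: first the left factor lies in `s`, then it is freed by
    -- the continuity of right multiplication by `y`.
    have hxt : ∀ t ∈ s, e (t * y) v = 0 := fun t ht => by
      obtain ⟨w, hw⟩ := exists_predual_mul_left e t v
      rw [hw]
      exact hy w fun z hz => by rw [← hw]; exact hv _ (s.mul_mem ht hz)
    obtain ⟨w, hw⟩ := exists_predual_mul_right e y v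
    rw [hw]
    exact hx w fun z hz => by rw [← hw]; exact hxt z hz
  add_mem' := by
    intro x y hx hy v hv
    rw [map_add, add_apply, hx v hv, hy v hv, add_zero]
  algebraMap_mem' := by
    intro c v hv
    rw [Algebra.algebraMap_eq_smul_one, map_smul, smul_apply, hv 1 s.one_mem, smul_zero]
  star_mem' := by
    intro x hx v hv
    obtain ⟨w, hw⟩ := exists_predual_star e v
    rw [← star_eq_zero, hw]
    exact hx w fun z hz => by rw [← hw, hv _ (hs z hz), star_zero]

variable [CompleteSpace Y] (s : Submonoid B) (hs : ∀ x ∈ s, star x ∈ s)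

theorem mem_generated {x : B} :
    x ∈ generated e s hs ↔ ∀ v ∈ preAnnihilator e s, e x v = 0 := Iff.rfl

instance isClosed_generated : IsClosed (generated e s hs : Set B) := by
  have : (generated e s hs : Set B) = ⋂ v ∈ preAnnihilator e (s : Set B),
      {x | predualEmbedding e v x = 0} := by
    ext x; simp [mem_generated]
  rw [this]
  exact isClosed_biInter fun v _ =>
    isClosed_eq (predualEmbedding e v).continuous continuous_const

/-- The identification of a generated W⋆-algebra with the dual of a quotient of the predual. -/
theorem exists_generated_dualEquiv :
    ∃ e' : generated e s hs ≃ₗᵢ[ℂ] StrongDual ℂ (Y ⧸ preAnnihilator e (s : Set B)),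
      ∀ x v, e' x (Submodule.Quotient.mk v) = e x.1 v := by
  set W := preAnnihilator e (s : Set B) with hW
  let L : generated e s hs → (Y ⧸ W) →ₗ[ℂ] ℂ := fun x => W.liftQ (e x.1).toLinearMap x.2
  have hLmk : ∀ x v, L x (Submodule.Quotient.mk v) = e x.1 v := fun x v => W.liftQ_apply _ _
  have hL : ∀ x q, ‖L x q‖ ≤ ‖x‖ * ‖q‖ := by
    intro x q
    refine le_of_forall_pos_le_add fun ε hε => ?_
    obtain ⟨v, rfl, hv⟩ := Submodule.Quotient.norm_mk_lt q
      (show 0 < ε / (‖x‖ + 1) by positivity)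
    rw [hLmk]
    have h2 : ‖e x.1 v‖ ≤ ‖x‖ * ‖v‖ := by
      refine ((e x.1).le_opNorm v).trans ?_
      rw [e.norm_map]; rfl
    have h3 : ‖x‖ * (ε / (‖x‖ + 1)) ≤ ε := by
      rw [mul_div_assoc', div_le_iff₀ (by positivity)]
      nlinarith [norm_nonneg x]
    calc _ ≤ ‖x‖ * ‖v‖ := h2
      _ ≤ ‖x‖ * (‖(Submodule.Quotient.mk v : Y ⧸ W)‖ + ε / (‖x‖ + 1)) := by gcongr
      _ ≤ _ := by rw [mul_add]; linarith
  let E₀ : generated e s hs →ₗ[ℂ] StrongDual ℂ (Y ⧸ W) :=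
    { toFun := fun x => (L x).mkContinuous ‖x‖ (hL x)
      map_add' := fun x y => by
        ext q
        obtain ⟨v, rfl⟩ := Submodule.Quotient.mk_surjective _ q
        change L (x + y) _ = L x _ + L y _
        simp only [hLmk, AddMemClass.coe_add, map_add, add_apply]
      map_smul' := fun c x => by
        ext q
        obtain ⟨v, rfl⟩ := Submodule.Quotient.mk_surjective _ q
        change L (c • x) _ = c • L x _
        simp only [hLmk, SetLike.val_smul, map_smul, smul_apply] }
  have hE : ∀ x v, E₀ x (Submodule.Quotient.mk v) = e x.1 v := hLmk
  have hmk : ∀ φ : StrongDual ℂ (Y ⧸ W), ∃ x : generated e s hs, E₀ x = φ ∧ ‖x‖ ≤ ‖φ‖ := by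
    intro φ
    let g : StrongDual ℂ Y := LinearMap.mkContinuous (φ.toLinearMap ∘ₗ W.mkQ) ‖φ‖ fun v => by
      refine (φ.le_opNorm _).trans ?_
      gcongr
      exact Submodule.Quotient.norm_mk_le _ v
    have hg : ∀ v, g v = φ (Submodule.Quotient.mk v) := fun v => rfl
    -- A functional on the quotient lifts to one on `Y` that kills the preannihilator, which is
    -- exactly membership in the bipolar.
    have hmem : e.symm g ∈ generated e s hs := by
      intro v hv
      rw [e.apply_symm_apply, hg, (Submodule.Quotient.mk_eq_zero W).2 hv, map_zero]
    refine ⟨⟨e.symm g, hmem⟩, ?_, ?_⟩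
    · ext q
      obtain ⟨v, rfl⟩ := Submodule.Quotient.mk_surjective _ q
      rw [hE, e.apply_symm_apply, hg]
    · change ‖e.symm g‖ ≤ _
      rw [e.symm.norm_map]
      exact LinearMap.mkContinuous_norm_le _ (norm_nonneg φ) _
  have hinj : Function.Injective E₀ := fun x y h => by
    refine Subtype.ext (e.injective ?_)
    ext v
    rw [← hE, ← hE, h]
  have hnorm : ∀ x, ‖E₀ x‖ = ‖x‖ := by
    intro x
    refine le_antisymm (LinearMap.mkContinuous_norm_le (L x) (norm_nonneg x) (hL x)) ?_
    obtain ⟨y, hy, hyn⟩ := hmk (E₀ x)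
    rwa [hinj hy] at hyn
  refine ⟨LinearIsometryEquiv.ofSurjective ⟨E₀, hnorm⟩ fun φ => ?_, hE⟩
  obtain ⟨x, hx, -⟩ := hmk φ
  exact ⟨x, hx⟩

end Generated

/-- Every `σ`-continuous contractive unital `*`-homomorphism into a W⋆-algebra restricts to an
element of `Ω(S)`. -/
theorem exists_sigmaRep {S : Type u} [Monoid S] [StarMul S] [TopologicalSpace S]
    {B Y : Type u} [CStarAlgebra B] [NormedAddCommGroup Y] [NormedSpace ℂ Y] [CompleteSpace Y]
    (e : B ≃ₗᵢ[ℂ] StrongDual ℂ Y) (ω : S →* B) (hstar : ∀ s, ω (star s) = star (ω s))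
    (hnorm : ∀ s, ‖ω s‖ ≤ 1) (hcont : ∀ v, Continuous fun s => e (ω s) v) :
    ∃ α : SigmaRep S, ∀ v : Y, ∃ ψ : α.X, ‖ψ‖ ≤ ‖v‖ ∧ ∀ s, α.hat ψ s = e (ω s) v := by
  have hs : ∀ x ∈ MonoidHom.mrange ω, star x ∈ MonoidHom.mrange ω := by
    rintro _ ⟨s, rfl⟩
    exact ⟨star s, hstar s⟩
  obtain ⟨e', he'⟩ := exists_generated_dualEquiv e (MonoidHom.mrange ω) hs
  have hmem : ∀ s, ω s ∈ generated e (MonoidHom.mrange ω) hs := fun s v hv => hv _ ⟨s, rfl⟩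
  let ω' : S → generated e (MonoidHom.mrange ω) hs := fun s => ⟨ω s, hmem s⟩
  let α : SigmaRep S :=
    { M := generated e (MonoidHom.mrange ω) hs
      X := Y ⧸ preAnnihilator e (MonoidHom.mrange ω : Set B)
      dualEquiv := e'
      ω := ω'
      map_mul := fun s t => Subtype.ext (map_mul ω s t)
      map_star := fun s => Subtype.ext (hstar s)
      norm_le_one := hnorm
      continuous_sigma := by
        refine continuous_induced_rng.2 (continuous_pi fun q => ?_)
        obtain ⟨v, rfl⟩ := Submodule.Quotient.mk_surjective _ q
        simpa only [Function.comp_def, he'] using hcont v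
      dense_span := by
        refine dense_sigma e' _ fun q hq => ?_
        obtain ⟨v, rfl⟩ := Submodule.Quotient.mk_surjective _ q
        rw [Submodule.Quotient.mk_eq_zero]
        rintro _ ⟨s, rfl⟩
        have := hq (ω' s) (Submodule.subset_span ⟨s, rfl⟩)
        rwa [he'] at this }
  exact ⟨α, fun v => ⟨Submodule.Quotient.mk v, Submodule.Quotient.norm_mk_le _ v, fun s => he' _ _⟩⟩

/-- Convergence in `Z` makes the functions converge uniformly on `T`. Hence continuity of
coefficients extends from a total set of vectors to all. -/
theorem isClosed_setOf_continuous {T Z : Type*} [TopologicalSpace T] [SeminormedAddCommGroup Z]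
    (F : Z → T → ℂ) (C : ℝ) (hF : ∀ z z' t, ‖F z t - F z' t‖ ≤ C * ‖z - z'‖) :
    IsClosed {z | Continuous (F z)} := by
  refine isClosed_of_closure_subset fun z hz => ?_
  refine continuous_of_uniform_approx_of_continuous fun u hu => ?_
  obtain ⟨ε, hε, hεu⟩ := Metric.mem_uniformity_dist.1 hu
  obtain ⟨z', hz', hd⟩ := Metric.mem_closure_iff.1 hz (ε / (|C| + 1)) (by positivity)
  refine ⟨F z', hz', fun t => hεu ?_⟩
  rw [dist_eq_norm] at hd ⊢
  calc _ ≤ C * ‖z - z'‖ := hF z z' t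
    _ ≤ (|C| + 1) * ‖z - z'‖ := by gcongr; linarith [le_abs_self C]
    _ < (|C| + 1) * (ε / (|C| + 1)) := by gcongr
    _ = ε := by field_simp

/-- Weakly continuous contractive `*`-representations on Hilbert spaces give elements of `Ω(S)`
whose predual contains the vector functionals. -/
theorem exists_sigmaRep_of_hilbert {S : Type u} [Monoid S] [StarMul S] [TopologicalSpace S]
    {H : Type u} [NormedAddCommGroup H] [InnerProductSpace ℂ H] [CompleteSpace H]
    (ρ : S →* (H →L[ℂ] H)) (hstar : ∀ s, ρ (star s) = star (ρ s)) (hnorm : ∀ s, ‖ρ s‖ ≤ 1)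
    (hcont : ∀ x y, Continuous fun s => ⟪x, ρ s y⟫_ℂ) :
    ∃ α : SigmaRep S, ∀ x y : H, ∃ ψ : α.X, ‖ψ‖ ≤ ‖x‖ * ‖y‖ ∧
      ∀ s, α.hat ψ s = ⟪x, ρ s y⟫_ℂ := by
  obtain ⟨Y, _, _, _, e, w, hw, hew, hspan⟩ := exists_predual_operators H
  have hc : ∀ v, Continuous fun s => e (ρ s) v := by
    let Q : Submodule ℂ Y :=
      { carrier := {v | Continuous fun s => e (ρ s) v}
        add_mem' := fun hv hw => by simpa [Pi.add_def] using hv.add hw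
        zero_mem' := by simpa using continuous_const
        smul_mem' := fun c v hv => by simpa using hv.const_mul c }
    have hQ : IsClosed (Q : Set Y) := by
      refine isClosed_setOf_continuous (fun v s => e (ρ s) v) 1 fun v v' s => ?_
      rw [← map_sub]
      refine ((e (ρ s)).le_opNorm _).trans ?_
      rw [e.norm_map]
      gcongr
      exact hnorm s
    intro v
    have : v ∈ Q := by
      rw [hspan Q hQ fun x y => by
        change Continuous fun s => e (ρ s) (w x y)
        simpa only [hew] using hcont x y]
      trivial
    exact this
  obtain ⟨α, hα⟩ := exists_sigmaRep e ρ hstar hnorm hc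
  refine ⟨α, fun x y => ?_⟩
  obtain ⟨ψ, hψ, hψs⟩ := hα (w x y)
  exact ⟨ψ, hψ.trans (hw x y), fun s => by rw [hψs, hew]⟩

end FourierStieltjes

/-! ### Representations built from positive semidefinite kernels -/

namespace FourierStieltjes

open Filter Topology Matrix
open scoped ComplexOrder InnerProductSpace ComplexConjugate

section Gram

variable {J : Type*}

/-- A test vector has finite support and meets finitely many blocks. Against it, `K` agrees with a
finite sum of Schur products of a block indicator with the pulled-back block. -/
theorem posSemidef_of_block {I T : Type*} {K : Matrix (I × T) (I × T) ℂ}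
    (h₀ : ∀ a b, a.1 ≠ b.1 → K a b = 0)
    (h : ∀ i, (of fun s t => K (i, s) (i, t) : Matrix T T ℂ).PosSemidef) : K.PosSemidef := by
  classical
  refine ⟨?_, fun x => ?_⟩
  · ext ⟨i, s⟩ ⟨j, t⟩
    rw [conjTranspose_apply]
    by_cases hij : i = j
    · subst hij
      exact (h i).isHermitian.apply s t
    · rw [h₀ (i, s) (j, t) hij, h₀ (j, t) (i, s) (Ne.symm hij), star_zero]
  · let v : I → I × T → ℂ := fun m a => if a.1 = m then 1 else 0
    let N : Matrix (I × T) (I × T) ℂ := ∑ m ∈ x.support.image Prod.fst,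
      of fun a b => (of fun a b => ⟪v m a, v m b⟫_ℂ : Matrix (I × T) (I × T) ℂ) a b *
        ((of fun s t => K (m, s) (m, t) : Matrix T T ℂ).submatrix Prod.snd Prod.snd) a b
    have hN : N.PosSemidef := posSemidef_sum _ fun m _ =>
      posSemidef_hadamard (posSemidef_inner _) ((h m).submatrix _)
    have hNK : ∀ a ∈ x.support, ∀ b, N a b = K a b := by
      intro a ha b
      simp only [N, Matrix.sum_apply, of_apply, submatrix_apply]
      rw [Finset.sum_eq_single a.1]
      · obtain ⟨i, s⟩ := a
        obtain ⟨j, t⟩ := b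
        by_cases hab : j = i
        · subst hab
          simp [v]
        · simp [v, hab, h₀ (i, s) (j, t) (Ne.symm hab)]
      · intro m _ hm
        simp [v, Ne.symm hm]
      · exact fun hn => absurd (Finset.mem_image_of_mem _ ha) hn
    refine (hN.2 x).trans_eq (Finset.sum_congr rfl fun a ha => Finset.sum_congr rfl fun b _ => ?_)
    simp only [hNK a ha b]

variable {H H' : Type*} [NormedAddCommGroup H] [InnerProductSpace ℂ H]
  [NormedAddCommGroup H'] [InnerProductSpace ℂ H']

theorem norm_sq_linearCombination_le {ξ : J → H} {η : J → H'} {r : ℝ}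
    (h : (of fun a b => (r : ℂ) * ⟪ξ a, ξ b⟫_ℂ - ⟪η a, η b⟫_ℂ : Matrix J J ℂ).PosSemidef)
    (c : J →₀ ℂ) :
    ‖Finsupp.linearCombination ℂ η c‖ ^ 2 ≤ r * ‖Finsupp.linearCombination ℂ ξ c‖ ^ 2 := by
  have key : (c.sum fun i xi => c.sum fun j xj => star xi *
        (of fun a b => (r : ℂ) * ⟪ξ a, ξ b⟫_ℂ - ⟪η a, η b⟫_ℂ : Matrix J J ℂ) i j * xj) =
      ((r * ‖Finsupp.linearCombination ℂ ξ c‖ ^ 2 -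
        ‖Finsupp.linearCombination ℂ η c‖ ^ 2 : ℝ) : ℂ) := by
    have hξ : ⟪Finsupp.linearCombination ℂ ξ c, Finsupp.linearCombination ℂ ξ c⟫_ℂ =
      Complex.ofReal ‖Finsupp.linearCombination ℂ ξ c‖ ^ 2 := inner_self_eq_norm_sq_to_K _
    have hη : ⟪Finsupp.linearCombination ℂ η c, Finsupp.linearCombination ℂ η c⟫_ℂ =
      Complex.ofReal ‖Finsupp.linearCombination ℂ η c‖ ^ 2 := inner_self_eq_norm_sq_to_K _
    push_cast
    rw [← hξ, ← hη]
    simp only [Finsupp.linearCombination_apply, Finsupp.sum, sum_inner, inner_sum,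
      inner_smul_left, inner_smul_right, of_apply, Finset.mul_sum, ← Finset.sum_sub_distrib,
      Complex.star_def]
    rw [Finset.sum_comm]
    refine Finset.sum_congr rfl fun i _ => Finset.sum_congr rfl fun j _ => ?_
    ring
  have := h.2 c
  rw [key, Complex.zero_le_real] at this
  linarith

theorem denseRange_linearCombination {ξ : J → H}
    (hξ : (Submodule.span ℂ (Set.range ξ)).topologicalClosure = ⊤) :
    DenseRange (Finsupp.linearCombination ℂ ξ) := by
  rw [DenseRange, ← LinearMap.coe_range, Finsupp.range_linearCombination]
  exact Submodule.dense_iff_topologicalClosure_eq_top.2 hξ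

/-- Domination of Gram kernels says that `ξ a ↦ η a` is well defined and bounded by `√r` on the
span; density extends it. -/
theorem exists_operator_of_posSemidef [CompleteSpace H'] {ξ : J → H} {η : J → H'} {r : ℝ}
    (hr : 0 ≤ r) (hξ : (Submodule.span ℂ (Set.range ξ)).topologicalClosure = ⊤)
    (h : (of fun a b => (r : ℂ) * ⟪ξ a, ξ b⟫_ℂ - ⟪η a, η b⟫_ℂ : Matrix J J ℂ).PosSemidef) :
    ∃ T : H →L[ℂ] H', (∀ a, T (ξ a) = η a) ∧ ‖T‖ ≤ √r := by
  have hd := denseRange_linearCombination hξ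
  have hn : ∀ c : J →₀ ℂ, ‖Finsupp.linearCombination ℂ η c‖ ≤
      √r * ‖Finsupp.linearCombination ℂ ξ c‖ := fun c => by
    refine (sq_le_sq₀ (norm_nonneg _) (by positivity)).1 ?_
    rw [mul_pow, Real.sq_sqrt hr]
    exact norm_sq_linearCombination_le h c
  refine ⟨(Finsupp.linearCombination ℂ η).extendOfNorm (Finsupp.linearCombination ℂ ξ),
    fun a => ?_, LinearMap.opNorm_extendOfNorm_le hd (Real.sqrt_nonneg r) hn⟩
  have := LinearMap.extendOfNorm_eq hd ⟨_, hn⟩ (Finsupp.single a 1)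
  simpa using this

/-- Operators on a Hilbert space agree if they agree on a total set. -/
theorem ext_of_total {ξ : J → H} (hξ : (Submodule.span ℂ (Set.range ξ)).topologicalClosure = ⊤)
    {A B : H →L[ℂ] H'} (h : ∀ a, A (ξ a) = B (ξ a)) : A = B := by
  refine ContinuousLinearMap.ext_on (s := Set.range ξ)
    (Submodule.dense_iff_topologicalClosure_eq_top.2 hξ) ?_
  rintro _ ⟨a, rfl⟩
  exact h a

theorem ext_inner_of_total {ξ : J → H}
    (hξ : (Submodule.span ℂ (Set.range ξ)).topologicalClosure = ⊤)
    {x y : H} (h : ∀ a, ⟪ξ a, x⟫_ℂ = ⟪ξ a, y⟫_ℂ) : x = y := by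
  have : innerSL ℂ x = innerSL ℂ y := by
    refine ext_of_total hξ fun a => ?_
    simp only [innerSL_apply_apply]
    rw [← inner_conj_symm, h, inner_conj_symm]
  exact ext_inner_right ℂ fun v => by simpa using congr($this v)

end Gram

/-- Positive semidefinite kernels are Gram matrices. -/
theorem exists_gram {J : Type u} {K : Matrix J J ℂ} (hK : K.PosSemidef) :
    ∃ (H : Type u) (_ : NormedAddCommGroup H) (_ : InnerProductSpace ℂ H) (_ : CompleteSpace H)
      (ξ : J → H), (∀ a b, ⟪ξ a, ξ b⟫_ℂ = K a b) ∧
        (Submodule.span ℂ (Set.range ξ)).topologicalClosure = ⊤ := by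
  -- The Hilbert space is the reproducing kernel space of `K`, with scalars read as operators on
  -- `ℂ`.
  let L : Matrix J J (ℂ →L[ℂ] ℂ) := of fun a b => K a b • (1 : ℂ →L[ℂ] ℂ)
  have hL : L.PosSemidef := by
    have h := (RKHS.posSemidef_tfae (K := L)).out 0 2
    refine h.2 ⟨?_, fun v => ?_⟩
    · ext a b
      simp only [conjTranspose_apply, L, of_apply, star_smul, hK.isHermitian.apply]
      simp
    · have := (Complex.le_def.1 (hK.2 v)).1
      refine this.trans_eq ?_
      refine congrArg Complex.re (Finset.sum_congr rfl fun a _ => Finset.sum_congr rfl fun b _ => ?_)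
      have hab : K a b = conj (K b a) := (hK.isHermitian.apply a b).symm
      simp [L, hab]
      ring
  have : Fact L.PosSemidef := ⟨hL⟩
  refine ⟨RKHS.OfKernel L, inferInstance, inferInstance, inferInstance,
    fun a => RKHS.kerFun (RKHS.OfKernel L) a (1 : ℂ), fun a b => ?_, ?_⟩
  · rw [← RKHS.kernel_inner, RKHS.OfKernel.kernel_ofKernel]
    simp [L]
    exact hK.isHermitian.apply a b
  · rw [← RKHS.kerFun_dense (RKHS.OfKernel L)]
    congr 1
    refine le_antisymm (Submodule.span_mono ?_) (Submodule.span_le.2 ?_)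
    · rintro _ ⟨a, rfl⟩
      exact ⟨a, 1, rfl⟩
    · rintro _ ⟨a, v, rfl⟩
      rw [show v = v • (1 : ℂ) by simp, map_smul]
      exact Submodule.smul_mem _ _ (Submodule.subset_span ⟨a, rfl⟩)

/-- A positive semidefinite kernel that is invariant and contractive under an action of `S`
gives a `*`-representation of `S` by contractions. -/
theorem exists_representation {S J : Type u} [Monoid S] [StarMul S] [MulAction S J]
    {K : Matrix J J ℂ} (hK : K.PosSemidef) (hinv : ∀ (s : S) a b, K (s • a) b = K a (star s • b))
    (hcontr : ∀ s : S, (of fun a b => K a b - K (s • a) (s • b) : Matrix J J ℂ).PosSemidef) :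
    ∃ (H : Type u) (_ : NormedAddCommGroup H) (_ : InnerProductSpace ℂ H) (_ : CompleteSpace H)
      (ξ : J → H) (ρ : S →* (H →L[ℂ] H)), (∀ a b, ⟪ξ a, ξ b⟫_ℂ = K a b) ∧
        (Submodule.span ℂ (Set.range ξ)).topologicalClosure = ⊤ ∧
        (∀ (s : S) a, ρ s (ξ a) = ξ (s • a)) ∧ (∀ s, ρ (star s) = star (ρ s)) ∧ ∀ s, ‖ρ s‖ ≤ 1 := by
  obtain ⟨H, _, _, _, ξ, hξ, hd⟩ := exists_gram hK
  have hex : ∀ s : S, ∃ T : H →L[ℂ] H, (∀ a, T (ξ a) = ξ (s • a)) ∧ ‖T‖ ≤ √1 := fun s => by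
    refine exists_operator_of_posSemidef zero_le_one hd ?_
    simpa only [hξ, Complex.ofReal_one, one_mul] using hcontr s
  choose T hT hTn using hex
  let ρ : S →* (H →L[ℂ] H) :=
    { toFun := T
      map_one' := ext_of_total hd fun a => by rw [hT, one_smul]; rfl
      map_mul' := fun s t => ext_of_total hd fun a => by
        rw [hT, mul_smul, mul_apply_eq_comp, hT, hT] }
  refine ⟨H, _, _, ‹_›, ξ, ρ, hξ, hd, hT, fun s => ?_, fun s => (hTn s).trans_eq Real.sqrt_one⟩
  refine ext_of_total hd fun a => ext_inner_of_total hd fun b => ?_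
  rw [ContinuousLinearMap.star_eq_adjoint, ContinuousLinearMap.adjoint_inner_right]
  change ⟪_, T _ _⟫_ℂ = ⟪T _ _, _⟫_ℂ
  rw [hT, hT, hξ, hξ, hinv]

/-- A vector functional of a representation with total weakly continuous coefficients is weakly
continuous. -/
theorem continuous_inner_of_total {S H J : Type*} [NormedAddCommGroup H] [InnerProductSpace ℂ H] [TopologicalSpace S]
    {ξ : J → H} (hd : (Submodule.span ℂ (Set.range ξ)).topologicalClosure = ⊤)
    {ρ : S → (H →L[ℂ] H)} (hρ : ∀ s, ‖ρ s‖ ≤ 1)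
    (h : ∀ a b, Continuous fun s => ⟪ξ a, ρ s (ξ b)⟫_ℂ) (x y : H) :
    Continuous fun s => ⟪x, ρ s y⟫_ℂ := by
  have hle : ∀ s y, ‖ρ s y‖ ≤ ‖y‖ := fun s y => by
    simpa using (ρ s).le_of_opNorm_le (hρ s) y
  have h1 : ∀ b, Continuous fun s => ⟪x, ρ s (ξ b)⟫_ℂ := by
    intro b
    let Q : Submodule ℂ H :=
      { carrier := {x | Continuous fun s => ⟪x, ρ s (ξ b)⟫_ℂ}
        add_mem' := fun hv hw => by simpa [inner_add_left] using! hv.add hw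
        zero_mem' := by simpa using! continuous_const
        smul_mem' := fun c v hv => by simpa [inner_smul_left, mul_comm] using! hv.const_mul (conj c) }
    have hQ : IsClosed (Q : Set H) :=
      isClosed_setOf_continuous (fun x s => ⟪x, ρ s (ξ b)⟫_ℂ) ‖ξ b‖ fun v v' s => by
        rw [← inner_sub_left]
        refine (norm_inner_le_norm _ _).trans ?_
        rw [mul_comm]
        gcongr
        exact hle _ _
    have : (⊤ : Submodule ℂ H) ≤ Q := by
      rw [← hd]
      refine Submodule.topologicalClosure_minimal _ (Submodule.span_le.2 ?_) hQ
      rintro _ ⟨a, rfl⟩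
      exact h a b
    exact this trivial
  let Q : Submodule ℂ H :=
    { carrier := {y | Continuous fun s => ⟪x, ρ s y⟫_ℂ}
      add_mem' := fun hv hw => by simpa [inner_add_right] using! hv.add hw
      zero_mem' := by simpa using! continuous_const
      smul_mem' := fun c v hv => by simpa [inner_smul_right] using! hv.const_mul c }
  have hQ : IsClosed (Q : Set H) :=
    isClosed_setOf_continuous (fun y s => ⟪x, ρ s y⟫_ℂ) ‖x‖ fun v v' s => by
      rw [← inner_sub_right, ← map_sub]
      refine (norm_inner_le_norm _ _).trans ?_
      gcongr
      exact hle _ _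
  have : (⊤ : Submodule ℂ H) ≤ Q := by
    rw [← hd]
    refine Submodule.topologicalClosure_minimal _ (Submodule.span_le.2 ?_) hQ
    rintro _ ⟨a, rfl⟩
    exact h1 a
  exact this trivial

/-- The direct sum of the Gelfand-Naimark-Segal representations of all coefficient functions. -/
theorem exists_sigmaRep_all_coefficients (S : Type u) [Monoid S] [StarMul S]
    [TopologicalSpace S] [ContinuousMul S] :
    ∃ U : SigmaRep S, ∀ (f : S → ℂ) (r : ℝ) (p : S → ℂ), IsCoefficient f r p →
      ∃ ψ : U.X, U.hat ψ = f ∧ ‖ψ‖ ≤ r := by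
  classical
  -- Indexing by `(f, r)`, with one `p` chosen for each, suffices: only `f` and the bound `r` have
  -- to be recovered.
  let I := {q : (S → ℂ) × ℝ // ∃ p, IsCoefficient q.1 q.2 p}
  choose p hp using fun i : I => i.2
  let _ : MulAction S (I × S) :=
    { smul := fun t a => (a.1, t * a.2)
      one_smul := fun a => Prod.ext rfl (one_mul _)
      mul_smul := fun s t a => Prod.ext rfl (mul_assoc _ _ _) }
  have hsmul : ∀ (t : S) (a : I × S), t • a = (a.1, t * a.2) := fun _ _ => rfl
  -- A block-diagonal kernel: its Gram space is the Hilbert sum of the GNS spaces.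
  let K : Matrix (I × S) (I × S) ℂ := of fun a b =>
    if a.1 = b.1 then p a.1 (star a.2 * b.2) else 0
  have hKe : ∀ a b, K a b = if a.1 = b.1 then p a.1 (star a.2 * b.2) else 0 := fun _ _ => rfl
  obtain ⟨H, _, _, _, ξ, ρ, hξ, hd, hρ, hstar, hnorm⟩ := exists_representation (S := S) (K := K)
    (posSemidef_of_block (fun a b hab => by simp [hKe, hab]) fun i => by
      simpa [hKe] using (hp i).posSemidef)
    (fun s a b => by simp only [hKe, hsmul, star_mul, mul_assoc])
    (fun s => posSemidef_of_block (fun a b hab => by simp [hKe, hsmul, hab]) fun i => by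
      simpa [hKe, hsmul, mul_assoc] using (hp i).contractive s)
  have hcont := continuous_inner_of_total hd hnorm fun a b => by
    simp only [hρ, hξ, hKe, hsmul]
    split_ifs with h
    · exact (hp a.1).continuous.comp (by fun_prop)
    · exact continuous_const
  obtain ⟨U, hU⟩ := exists_sigmaRep_of_hilbert ρ hstar hnorm hcont
  refine ⟨U, fun f r q hq => ?_⟩
  let i : I := ⟨(f, r), q, hq⟩
  have hnξ : ‖ξ (i, 1)‖ ^ 2 = r := by
    have h1 : ⟪ξ (i, 1), ξ (i, 1)⟫_ℂ = (r : ℂ) := by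
      rw [hξ, hKe]
      simpa using (hp i).map_one
    have h2 : ⟪ξ (i, 1), ξ (i, 1)⟫_ℂ = Complex.ofReal ‖ξ (i, 1)‖ ^ 2 :=
      inner_self_eq_norm_sq_to_K _
    exact_mod_cast h2.symm.trans h1
  have hr : 0 ≤ r := hnξ ▸ sq_nonneg _
  -- By `dominated`, `f` defines a functional `T` of norm at most `√r` on the block of `i`, extended
  -- by `0`. Then `f s = T (ρ s (ξ (i, 1)))`, and `‖ξ (i, 1)‖ = √r` makes the total norm at most
  -- `r`.
  obtain ⟨T, hT, hTn⟩ := exists_operator_of_posSemidef (H' := ℂ) (r := r) hr hd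
    (η := fun a => if a.1 = i then f a.2 else 0) (by
      refine posSemidef_of_block (fun a b hab => ?_) fun j => ?_
      · by_cases ha : a.1 = i
        · have hb : b.1 ≠ i := fun hb => hab (ha.trans hb.symm)
          simp [hξ, hKe, hab, hb]
        · simp [hξ, hKe, hab, ha]
      · by_cases hj : j = i
        · subst hj
          simpa [hξ, hKe, i, mul_comm] using (hp i).dominated
        · have := (hp j).posSemidef.smul (α := ℂ) (Complex.zero_le_real.2 hr)
          convert this using 1
          ext s t
          simp [hξ, hKe, hj])
  obtain ⟨ψ, hψ, hψs⟩ := hU ((InnerProductSpace.toDual ℂ H).symm T) (ξ (i, 1))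
  refine ⟨ψ, funext fun s => ?_, hψ.trans ?_⟩
  · rw [hψs, InnerProductSpace.toDual_symm_apply, hρ, hT]
    simp [hsmul]
  · rw [LinearIsometryEquiv.norm_map, ← Real.sqrt_sq (norm_nonneg (ξ (i, 1))), hnξ]
    calc _ ≤ √r * √r := by gcongr
      _ = r := Real.mul_self_sqrt hr

end FourierStieltjes

/-! ### Universality and the Banach algebra `F(S)` -/

namespace FourierStieltjes

open Filter Topology

section Semigroup

variable {S : Type u} [Semigroup S] [StarMul S] [TopologicalSpace S]

/-- Every function in `F(S)` is represented in the predual of `U`, without increase of norm. -/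
def SigmaRep.IsDominating (U : SigmaRep S) : Prop :=
  ∀ (α : SigmaRep S) (ψ : α.X), ∃ φ : U.X, U.hat φ = α.hat ψ ∧ ‖φ‖ ≤ ‖ψ‖

/-- Injectivity of `U.hat` makes the choice of `φ` unique, hence linear in `ψ`. -/
theorem SigmaRep.IsDominating.exists_linear {U : SigmaRep S} (hU : U.IsDominating)
    (α : SigmaRep S) :
    ∃ Λ : α.X →L[ℂ] U.X, ∀ ψ, U.hat (Λ ψ) = α.hat ψ ∧ ‖Λ ψ‖ ≤ ‖ψ‖ := by
  choose Λ hΛ hn using hU α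
  refine ⟨LinearMap.mkContinuous
    { toFun := Λ
      map_add' := fun ψ φ => U.hat_injective <| by
        rw [U.hat_add, hΛ, hΛ, hΛ, α.hat_add]
      map_smul' := fun c ψ => U.hat_injective <| by
        rw [RingHom.id_apply, U.hat_smul, hΛ, hΛ, α.hat_smul] } 1
      fun ψ => (hn ψ).trans_eq (_root_.one_mul _).symm, fun ψ => ⟨hΛ ψ, hn ψ⟩⟩

theorem SigmaRep.IsDominating.exists_linearIsometryEquiv {U V : SigmaRep S} (hU : U.IsDominating)
    (hV : V.IsDominating) : ∃ T : U.X ≃ₗᵢ[ℂ] V.X, ∀ ψ, V.hat (T ψ) = U.hat ψ := by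
  obtain ⟨T, hT⟩ := hV.exists_linear U
  obtain ⟨R, hR⟩ := hU.exists_linear V
  have hRT : ∀ ψ, R (T ψ) = ψ := fun ψ => U.hat_injective <| by rw [(hR _).1, (hT _).1]
  have hTR : ∀ ψ, T (R ψ) = ψ := fun ψ => V.hat_injective <| by rw [(hT _).1, (hR _).1]
  refine ⟨⟨LinearEquiv.ofLinearMap (T : U.X →ₗ[ℂ] V.X) (R : V.X →ₗ[ℂ] U.X) (LinearMap.ext hTR)
    (LinearMap.ext hRT), fun ψ => le_antisymm (hT ψ).2 ?_⟩, fun ψ => (hT ψ).1⟩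
  have := (hR (T ψ)).2
  rwa [hRT] at this

theorem SigmaRep.IsDominating.range_hat {U : SigmaRep S} (hU : U.IsDominating) :
    Set.range U.hat = F S := by
  ext f
  constructor
  · rintro ⟨ψ, rfl⟩
    exact ⟨U, ψ, rfl⟩
  · rintro ⟨α, ψ, rfl⟩
    obtain ⟨φ, hφ, -⟩ := hU α ψ
    exact ⟨φ, hφ⟩

theorem SigmaRep.IsDominating.normΩ_hat {U : SigmaRep S} (hU : U.IsDominating) (ψ : U.X) :
    normΩ (U.hat ψ) = ‖ψ‖ := by
  refine IsLeast.csInf_eq ⟨⟨U, ψ, rfl, rfl⟩, ?_⟩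
  rintro _ ⟨α, φ, hφ, rfl⟩
  obtain ⟨ψ', hψ', hn⟩ := hU α φ
  rwa [U.hat_injective (hψ'.trans hφ)] at hn

end Semigroup

section Monoid

variable {S : Type u} [Monoid S] [StarMul S] [TopologicalSpace S]

/-- Take `φ = ψ ∘ θ`: it lies in the predual because `θ` is `σ`-continuous, and its norm does not
grow because `*`-homomorphisms are contractive. -/
theorem SigmaRep.IsUniversal.isDominating {U : SigmaRep S} (hU : U.IsUniversal) :
    U.IsDominating := by
  intro α ψ
  obtain ⟨θ, hθ, hω⟩ := hU α
  let g : StrongDual ℂ U.M := LinearMap.mkContinuous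
    ((predualEmbedding α.dualEquiv ψ).toLinearMap ∘ₗ θ.toAlgHom.toLinearMap) ‖ψ‖ fun x => by
      refine ((predualEmbedding α.dualEquiv ψ).le_opNorm (θ x)).trans ?_
      rw [LinearIsometry.norm_map]
      gcongr
      exact NonUnitalStarAlgHom.norm_apply_le θ x
  have hg : ∀ x, g x = α.dualEquiv (θ x) ψ := fun x => rfl
  have hgc : @Continuous _ _ (sigma U.dualEquiv) _ g :=
    @Continuous.comp _ _ _ (sigma U.dualEquiv) (sigma α.dualEquiv) _ _ _
      (α.continuous_dualEquiv ψ) hθ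
  obtain ⟨φ, hφ⟩ := exists_predual_of_tendsto_zero (e := U.dualEquiv) g fun V _ hV => by
    have h0 : Tendsto id (V : Filter U.M) (@nhds _ (sigma U.dualEquiv) 0) := by
      rw [nhds_induced, tendsto_comap_iff, tendsto_pi_nhds]
      exact hV
    have := (@Continuous.tendsto _ _ (sigma U.dualEquiv) _ _ hgc 0).comp h0
    rwa [map_zero] at this
  refine ⟨φ, funext fun s => ?_, ?_⟩
  · rw [SigmaRep.hat, ← hφ, hg, hω]; rfl
  · have : predualEmbedding U.dualEquiv φ = g := by ext x; simp [hφ]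
    rw [← (predualEmbedding U.dualEquiv).norm_map, this]
    exact LinearMap.mkContinuous_norm_le _ (norm_nonneg ψ) _

/-- `θ` is the adjoint of `Λ`, so its `σ`-continuity is automatic. The algebraic identities hold on
`ω(S)` and extend by separate continuity and density, the latter in the form of injectivity of
`hat`. -/
theorem SigmaRep.IsDominating.isUniversal {U : SigmaRep S} (hU : U.IsDominating) :
    U.IsUniversal := by
  intro α
  obtain ⟨Λ, hΛ⟩ := hU.exists_linear α
  let θ : U.M →ₗ[ℂ] α.M :=
    { toFun := fun x => α.dualEquiv.symm ((U.dualEquiv x).comp Λ)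
      map_add' := fun x y => by rw [map_add, ContinuousLinearMap.add_comp, map_add]
      map_smul' := fun c x => by
        rw [map_smul, ContinuousLinearMap.smul_comp, map_smul, RingHom.id_apply] }
  have hθ : ∀ x ψ, α.dualEquiv (θ x) ψ = U.dualEquiv x (Λ ψ) := fun x ψ => by
    change α.dualEquiv (α.dualEquiv.symm _) ψ = _
    rw [LinearIsometryEquiv.apply_symm_apply]; rfl
  have hext : ∀ {x y : α.M}, (∀ ψ, α.dualEquiv x ψ = α.dualEquiv y ψ) → x = y := fun h =>
    α.dualEquiv.injective (ContinuousLinearMap.ext h)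
  have hω : ∀ s, θ (U.ω s) = α.ω s := fun s => hext fun ψ => by
    rw [hθ]; exact congrFun (hΛ ψ).1 s
  have hΛ_eq : ∀ {ψ φ}, (∀ s, α.hat ψ s = U.hat φ s) → Λ ψ = φ := fun h =>
    U.hat_injective ((hΛ _).1.trans (funext h))
  -- Multiplicativity is extended one factor at a time: the left one here, the right one in `hmul`.
  have hmul_ω : ∀ x t, θ (x * U.ω t) = θ x * α.ω t := fun x t => hext fun ψ => by
    obtain ⟨φ, hφ⟩ := exists_predual_mul_right α.dualEquiv (α.ω t) ψ
    obtain ⟨φ', hφ'⟩ := exists_predual_mul_right U.dualEquiv (U.ω t) (Λ ψ)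
    have : Λ φ = φ' := hΛ_eq fun s => by
      rw [SigmaRep.hat, SigmaRep.hat, ← hφ, ← hφ', ← α.map_mul, ← U.map_mul, ← hθ, hω]
    rw [hφ, hθ, hθ, hφ', this]
  have hmul : ∀ x y, θ (x * y) = θ x * θ y := fun x y => hext fun ψ => by
    obtain ⟨φ, hφ⟩ := exists_predual_mul_left α.dualEquiv (θ x) ψ
    obtain ⟨φ', hφ'⟩ := exists_predual_mul_left U.dualEquiv x (Λ ψ)
    have : Λ φ = φ' := hΛ_eq fun s => by
      rw [SigmaRep.hat, SigmaRep.hat, ← hφ, ← hφ', ← hmul_ω, hθ]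
    rw [hφ, hθ, hθ, hφ', this]
  have hstar : ∀ x, θ (star x) = star (θ x) := fun x => hext fun ψ => by
    obtain ⟨φ, hφ⟩ := exists_predual_star α.dualEquiv ψ
    obtain ⟨φ', hφ'⟩ := exists_predual_star U.dualEquiv (Λ ψ)
    have : Λ φ = φ' := hΛ_eq fun s => by
      rw [SigmaRep.hat, SigmaRep.hat, ← hφ, ← hφ', ← α.map_star, ← U.map_star, ← hθ, hω]
    refine star_injective ?_
    rw [hφ, hθ, hθ, hφ', this]
  have hone : θ 1 = 1 := by rw [← U.map_one, hω, α.map_one]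
  refine ⟨⟨AlgHom.ofLinearMap θ hone hmul, hstar⟩, ?_, hω⟩
  let _ := sigma U.dualEquiv
  refine continuous_induced_rng.2 (continuous_pi fun ψ => ?_)
  exact (U.continuous_dualEquiv (Λ ψ)).congr fun x => (hθ x ψ).symm

/-- Isometric Banach spaces have isometric duals. -/
theorem exists_strongDual_congr {X A : Type*} [NormedAddCommGroup X] [NormedSpace ℂ X]
    [NormedAddCommGroup A] [NormedSpace ℂ A] (Φ : X ≃ₗᵢ[ℂ] A) :
    ∃ D : StrongDual ℂ X ≃ₗᵢ[ℂ] StrongDual ℂ A, ∀ f x, D f (Φ x) = f x := by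
  refine ⟨⟨(Φ.toContinuousLinearEquiv.arrowCongr
    (ContinuousLinearEquiv.refl ℂ ℂ)).toLinearEquiv, fun f => ?_⟩, fun f x => ?_⟩
  · exact ContinuousLinearMap.opNorm_comp_linearIsometryEquiv f Φ.symm
  · exact congrArg f (Φ.symm_apply_apply x)

/-- The unital Banach algebra structure on a Banach space of functions. -/
theorem exists_normedAlgebra {T : Type*} {X : Type u} [NormedAddCommGroup X] [NormedSpace ℂ X]
    (h : X →ₗ[ℂ] (T → ℂ)) (hinj : Function.Injective h)
    (hmul : ∀ x y, ∃ z, h z = h x * h y ∧ ‖z‖ ≤ ‖x‖ * ‖y‖) (hone : ∃ z, h z = 1) :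
    ∃ (A : Type u) (_ : NormedCommRing A) (_ : NormedAlgebra ℂ A) (ι : A →ₐ[ℂ] (T → ℂ))
      (Φ : X ≃ₗᵢ[ℂ] A), ∀ x, ι (Φ x) = h x := by
  choose mul hm hn using hmul
  obtain ⟨one, ho⟩ := hone
  -- Every ring axiom is inherited from the functions on `T` through the injection `h`.
  let i₁ : NormedCommRing X :=
    { ‹NormedAddCommGroup X› with
      mul := mul
      one := one
      left_distrib := fun a b c => hinj <| by
        change h (mul a (b + c)) = h (mul a b + mul a c)
        simp only [hm, map_add, mul_add]
      right_distrib := fun a b c => hinj <| by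
        change h (mul (a + b) c) = h (mul a c + mul b c)
        simp only [hm, map_add, add_mul]
      zero_mul := fun a => hinj <| by
        change h (mul 0 a) = h 0
        simp only [hm, map_zero, zero_mul]
      mul_zero := fun a => hinj <| by
        change h (mul a 0) = h 0
        simp only [hm, map_zero, mul_zero]
      mul_assoc := fun a b c => hinj <| by
        change h (mul (mul a b) c) = h (mul a (mul b c))
        simp only [hm, mul_assoc]
      one_mul := fun a => hinj <| by
        change h (mul one a) = h a
        simp only [hm, ho, one_mul]
      mul_one := fun a => hinj <| by
        change h (mul a one) = h a
        simp only [hm, ho, mul_one]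
      mul_comm := fun a b => hinj <| by
        change h (mul a b) = h (mul b a)
        simp only [hm, mul_comm]
      norm_mul_le := hn }
  let i₂ : NormedAlgebra ℂ X :=
    { Algebra.ofModule
        (fun c x y => hinj <| by
          change h (mul (c • x) y) = h (c • mul x y)
          simp only [hm, map_smul, smul_mul_assoc])
        (fun c x y => hinj <| by
          change h (mul x (c • y)) = h (c • mul x y)
          simp only [hm, map_smul, mul_smul_comm]) with
      norm_smul_le := fun c x => norm_smul_le c x }
  exact ⟨X, i₁, i₂, AlgHom.ofLinearMap h ho hm, LinearIsometryEquiv.refl ℂ X, fun x => rfl⟩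

/-- Evaluation at a point is multiplicative, and it is nonzero because it takes the value `1` on the
constant `1`. -/
theorem isFAlgebraVia_of_apply_one {T : Type*} [Monoid T] {A : Type u} [NormedCommRing A] [NormedAlgebra ℂ A]
    [CompleteSpace A] {M : Type u} [CStarAlgebra M] (e : M ≃ₗᵢ[ℂ] StrongDual ℂ A)
    (ι : A →ₐ[ℂ] (T → ℂ)) (h : ∀ a, e 1 a = ι a 1) : IsFAlgebraVia e where
  complete := ‹_›
  one_mul a b := by rw [h, h, h, map_mul, Pi.mul_apply]
  one_ne_zero h0 := by
    have := h 1
    rw [h0, map_one ι, zero_apply, Pi.one_apply] at this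
    exact zero_ne_one this

variable (S) in
-- Every `ψ̂`, every product of two such functions and the constant `1` are coefficient functions
-- with the expected bounds, so one representation realises them all.
theorem exists_isDominating [ContinuousMul S] : ∃ U : SigmaRep S, U.IsDominating ∧
    (∀ ψ φ : U.X, ∃ χ : U.X, U.hat χ = U.hat ψ * U.hat φ ∧ ‖χ‖ ≤ ‖ψ‖ * ‖φ‖) ∧
    ∃ χ : U.X, U.hat χ = 1 := by
  obtain ⟨U, hU⟩ := exists_sigmaRep_all_coefficients S
  refine ⟨U, fun α ψ => ?_, fun ψ φ => ?_, ?_⟩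
  · obtain ⟨p, hp⟩ := α.exists_isCoefficient_hat ψ
    exact hU _ _ _ hp
  · obtain ⟨p, hp⟩ := U.exists_isCoefficient_hat ψ
    obtain ⟨q, hq⟩ := U.exists_isCoefficient_hat φ
    exact hU _ _ _ (hp.mul hq)
  · obtain ⟨χ, hχ, -⟩ := hU _ _ _ isCoefficient_one
    exact ⟨χ, hχ⟩

end Monoid

end FourierStieltjes

open FourierStieltjes in
theorem proposition3p3 (S : Type u) [Monoid S] [TopologicalSpace S] [ContinuousMul S]
    [StarMul S] [ContinuousStar S] :
    ∃ (A : Type u) (_ : NormedCommRing A) (_ : NormedAlgebra ℂ A) (ι : A →ₐ[ℂ] (S → ℂ)),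
      IsFourierStieltjesAlgebra A ι ∧
      IsFAlgebra A ∧
      (∃ U : SigmaRep S, U.IsUniversal) ∧
      ∀ U : SigmaRep S, U.IsUniversal →
        ∃ (Φ : U.X ≃ₗᵢ[ℂ] A) (e : U.M ≃ₗᵢ[ℂ] StrongDual ℂ A),
          (∀ ψ, ι (Φ ψ) = U.hat ψ) ∧ (∀ x ψ, e x (Φ ψ) = U.dualEquiv x ψ) ∧
          IsFAlgebraVia e := by
  obtain ⟨V, hV, hmul, hone⟩ := exists_isDominating S
  obtain ⟨A, _, _, ι, Φ, hΦ⟩ := exists_normedAlgebra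
    { toFun := V.hat, map_add' := V.hat_add, map_smul' := V.hat_smul } V.hat_injective hmul hone
  replace hΦ : ∀ ψ, ι (Φ ψ) = V.hat ψ := hΦ
  have : CompleteSpace A := (completeSpace_congr (e := Φ.toEquiv) Φ.isometry.isUniformEmbedding).1 inferInstance
  -- `A` is modelled on the fixed `V`; any other dominating `U` has a predual isometric to that of
  -- `V`, compatibly with `hat`.
  have key : ∀ U : SigmaRep S, U.IsDominating →
      ∃ (Φ : U.X ≃ₗᵢ[ℂ] A) (e : U.M ≃ₗᵢ[ℂ] StrongDual ℂ A),
        (∀ ψ, ι (Φ ψ) = U.hat ψ) ∧ (∀ x ψ, e x (Φ ψ) = U.dualEquiv x ψ) ∧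
        IsFAlgebraVia e := by
    intro U hU
    obtain ⟨T, hT⟩ := hU.exists_linearIsometryEquiv hV
    have hΨ : ∀ ψ, ι (T.trans Φ ψ) = U.hat ψ := fun ψ => by
      rw [LinearIsometryEquiv.trans_apply, hΦ, hT]
    obtain ⟨D, hD⟩ := exists_strongDual_congr (T.trans Φ)
    have he : ∀ x ψ, U.dualEquiv.trans D x (T.trans Φ ψ) = U.dualEquiv x ψ := fun x => hD _
    refine ⟨T.trans Φ, _, hΨ, he, isFAlgebraVia_of_apply_one _ ι fun a => ?_⟩
    obtain ⟨ψ, rfl⟩ := (T.trans Φ).surjective a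
    rw [he, hΨ, SigmaRep.hat, U.map_one]
  refine ⟨A, _, _, ι, ⟨this, ?_, ?_, ?_⟩, ?_, ⟨V, hV.isUniversal⟩,
    fun U hU => key U hU.isDominating⟩
  · intro a b hab
    obtain ⟨ψ, rfl⟩ := Φ.surjective a
    obtain ⟨φ, rfl⟩ := Φ.surjective b
    rw [hΦ, hΦ] at hab
    rw [V.hat_injective hab]
  · rw [← hV.range_hat, ← Φ.surjective.range_comp]
    exact congrArg Set.range (funext hΦ)
  · intro a
    obtain ⟨ψ, rfl⟩ := Φ.surjective a
    rw [hΦ, hV.normΩ_hat, Φ.norm_map]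
  · obtain ⟨-, e, -, -, he⟩ := key V hV
    exact ⟨V.M, inferInstance, e, he⟩
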